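/- **Setup.** Let $\mathbb F$ be a field of characteristic $0$, $\mathfrak g$ a finite-dimensional reductive Lie algebra over $\mathbb F$ with a non-degenerate symmetric invariant bilinear form $\kappa$, and $(f,2x,e)$ an $\mathfrak{sl}_2$-triple in $\mathfrak g$ (so $[2x,e]=2e$, $[2x,f]=-2f$, $[e,f]=2x\neq 0$), with $\operatorname{ad}x$-eigenspace decomposition $\mathfrak g=\bigoplus_{i\in\frac12\mathbb Z}\mathfrak g_i$. Let $\mathfrak l\subset\mathfrak g_{1/2}$ be isotropic for $\omega(a,b)=\kappa(f\mid[a,b])$, let $\mathfrak l^{\perp\omega}\subset\mathfrak g_{1/2}$ be its $\omega$-orthogonal complement, and put $\mathfrak m=\mathfrak l\oplus\mathfrak g_{\ge1}$, $\mathfrak n=\mathfrak l^{\perp\omega}\oplus\mathfrak g_{\ge 1}$. Let $\mathfrak p\subset\mathfrak g_{\le\frac12}$ satisfy $\mathfrak g=\mathfrak m\oplus\mathfrak p$, let $(q_i)_{i\in P}$ be a basis of $\mathfrak p$ and $(q^i)_{i\in P}$ the $\kappa$-dual basis of $\mathfrak m^\perp$. Let $s\in\mathfrak g$ satisfy $[s,\mathfrak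 n]=0$ and $[x,s]=ms$ with $m\in\frac12\mathbb Z$, and assume $$\mathfrak g((z^{-1}))=\operatorname{Ker}\operatorname{ad}(f+zs)\oplus\operatorname{Im}\operatorname{ad}(f+zs).$$ Put $\mathfrak h=\operatorname{Ker}\operatorname{ad}(f+zs)\subset\mathfrak g((z^{-1}))$, with centre $Z(\mathfrak h)$. Grade $\mathfrak g((z^{-1}))$ by the $\operatorname{ad}x$-eigenvalue and $\deg z=-m-1$, so that $f+zs$ has degree $-1$. For a vector space $\mathfrak a$ let $\mathcal V(\mathfrak a)=S(\mathbb F[\partial]\mathfrak a)$ be the algebra of differential polynomials in (a basis of) $\mathfrak a$. For $z\in\mathbb F$ let $\{\cdot_\lambda\cdot\}_z$ be the $\lambda$-bracket on $\mathcal V(\mathfrak g)$ with $\{a_\lambda b\}_z=[a,b]+\kappa(a\mid b)\lambda+z\kappa(s\mid[a,b])$ for $a,b\in\mathfrak g$, extended by the Master Formula $$\{g_\lambda k\}=\sum_{i,j,n,r}\frac{\partial k}{\partial u_j^{(n)}}(\lambda+\partial)^n\{u_i{}_{\lambda+\partial}u_j\}_{\to}(-\lambda-\partial)^r\frac{\partial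 g}{\partial u_i^{(r)}}$$ ($(u_i)$ a basis of $\mathfrak g$; the arrow means that $\partial$ acts on everything to its right). Let $\rho:\mathcal V(\mathfrak g)\to\mathcal V(\mathfrak p)$ be the differential algebra homomorphism with $\rho(a)=\pi_{\mathfrak p}(a)+\kappa(f\mid a)$ for $a\in\mathfrak g$, where $\pi_{\mathfrak p}$ is the projection with kernel $\mathfrak m$. The classical $\mathcal W$-algebra is $\mathcal W=\{p\in\mathcal V(\mathfrak p)\mid\rho\{a_\lambda p\}_z=0\ \text{for all } a\in\mathfrak n\}$, which does not depend on $z$. Write $\int$ for the quotient map $\mathcal V(\mathfrak p)\to\mathcal V(\mathfrak p)/\partial\mathcal V(\mathfrak p)$, and $\frac{\delta g}{\delta q}=\sum_{i\in P}q_i\otimes\sum_{n\ge0}(-\partial)^n\frac{\partial g}{\partial q_i^{(n)}}$; both are applied coefficientwise to Laurent series in $z^{-1}$, and $\frac{\delta g}{\delta q}$ depends only on $\int g$. Let $$L(z)=\partial+\sum_{i\in P}q^i\otimes q_i+(f+zs)\otimes1$$ in the Lie algebra $\mathbb F\partial\ltimes(\mathfrak g\otimes\mathcal V(\mathfrak p))((z^{-1}))$,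 and extend $\kappa$ to a $\mathcal V(\mathfrak p)((z^{-1}))$-bilinear map by $\kappa(a\otimes u\mid b\otimes v)=\kappa(a\mid b)uv$. Below, $\mathfrak a\,\widehat\otimes\,\mathcal V(\mathfrak p)$, for a subspace $\mathfrak a\subset\mathfrak g((z^{-1}))$, denotes the space of the series in $(\mathfrak g\otimes\mathcal V(\mathfrak p))((z^{-1}))$ all of whose contractions with linear forms on $\mathcal V(\mathfrak p)$ lie in $\mathfrak a$. **Theorem.** Let $U(z)\in\mathfrak g((z^{-1}))_{>0}\,\widehat\otimes\,\mathcal V(\mathfrak p)$ and $h(z)\in\mathfrak h_{>-1}\,\widehat\otimes\,\mathcal V(\mathfrak p)$ be any solution of $$e^{\operatorname{ad}U(z)}L(z)=\partial+(f+zs)\otimes1+h(z),$$ and let $a(z)\in Z(\mathfrak h)$. Then $$\textstyle\int g(z)=\int\kappa(a(z)\otimes1\mid h(z))\in\big(\mathcal V(\mathfrak p)/\partial\mathcal V(\mathfrak p)\big)((z^{-1}))$$ solves the Lenard–Magri recursion: for every $p\in\mathcal W$, $$\int\kappa\Big(\Big[L(z),\frac{\delta g(z)}{\delta q}\Big]\,\Big|\,\frac{\delta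 p}{\delta q}\Big)=0\quad\text{in }\big(\mathcal V(\mathfrak p)/\partial\mathcal V(\mathfrak p)\big)((z^{-1})).$$ -/

import Mathlib

open scoped TensorProduct

noncomputable section

namespace DSW

/-! ### Algebras of differential polynomials -/

/-- The algebra of differential polynomials `F[u_i^{(n)} | i ∈ ι, n ∈ ℕ]`; the variable `(i, n)` is
`u_i^{(n)}`. -/
abbrev DiffPoly (F : Type*) (ι : Type*) [Field F] : Type _ := MvPolynomial (ι × ℕ) F

variable {F : Type*} [Field F] {ι : Type*}

/-- The derivation `∂` with `∂ u_i^{(n)} = u_i^{(n+1)}`. -/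
def del : Derivation F (DiffPoly F ι) (DiffPoly F ι) :=
  MvPolynomial.mkDerivation F fun v => MvPolynomial.X (v.1, v.2 + 1)

theorem pderiv_support_finite (i : ι) (g : DiffPoly F ι) :
    {n : ℕ | MvPolynomial.pderiv (i, n) g ≠ 0}.Finite := by
  classical
  refine ((g.vars.image Prod.snd).finite_toSet).subset fun n hn => ?_
  by_contra h
  refine hn (MvPolynomial.pderiv_eq_zero_of_notMem_vars fun hv => h ?_)
  exact Finset.mem_coe.2 (Finset.mem_image.2 ⟨(i, n), hv, rfl⟩)

theorem varTerm_support_finite (i : ι) (g : DiffPoly F ι) :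
    (Function.support fun n : ℕ =>
      ((-(del : Derivation F (DiffPoly F ι) (DiffPoly F ι)).toLinearMap) ^ n)
        (MvPolynomial.pderiv (i, n) g)).Finite := by
  refine (pderiv_support_finite i g).subset fun n hn => ?_
  intro h
  exact hn (by simp only [h, map_zero])

/-- The variational derivative `δg/δu_i = ∑_n (-∂)^n ∂g/∂u_i^{(n)}` (a finite sum). -/
def varDer (i : ι) : DiffPoly F ι →ₗ[F] DiffPoly F ι where
  toFun g := ∑ᶠ n : ℕ,
    ((-(del : Derivation F (DiffPoly F ι) (DiffPoly F ι)).toLinearMap) ^ n)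
      (MvPolynomial.pderiv (i, n) g)
  map_add' g g' := by
    rw [← finsum_add_distrib (varTerm_support_finite i g) (varTerm_support_finite i g')]
    simp only [map_add]
  map_smul' c g := by
    rw [RingHom.id_apply, smul_finsum' c (varTerm_support_finite i g)]
    simp only [map_smul, Derivation.map_smul]

/-! ### Lambda-brackets: elements of `𝒱[λ]` are polynomials with coefficients in `𝒱` -/

/-- The operator `λ + ∂` on `𝒱[λ]`. -/
def lamDel : Module.End F (Polynomial (DiffPoly F ι)) :=
  LinearMap.mulLeft F Polynomial.X +
    Polynomial.lsum fun n =>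
      ((Polynomial.monomial n).restrictScalars F) ∘ₗ
        (del : Derivation F (DiffPoly F ι) (DiffPoly F ι)).toLinearMap

/-- For `A(λ) = ∑ c_k λ^k` and `w ∈ 𝒱[λ]`, the element `A(λ + ∂) w = ∑ c_k (λ + ∂)^k w`. -/
def applyShift (A w : Polynomial (DiffPoly F ι)) : Polynomial (DiffPoly F ι) :=
  A.sum fun k c => Polynomial.C c * (lamDel ^ k) w

/-- The lambda-bracket `{f_λ g}` on differential polynomials given by the Master Formula
`∑ ∂g/∂u_j^{(n)} (λ+∂)^n H_{ji}(λ+∂) (-λ-∂)^m ∂f/∂u_i^{(m)}`, for which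
`{u_i _λ u_j} = H_{ji}(λ)`. All sums are finite. -/
def masterBracket [Fintype ι] (H : ι → ι → Polynomial (DiffPoly F ι)) (f g : DiffPoly F ι) :
    Polynomial (DiffPoly F ι) :=
  ∑ i : ι, ∑ j : ι, ∑ᶠ m : ℕ, ∑ᶠ n : ℕ,
    Polynomial.C (MvPolynomial.pderiv (j, n) g) *
      (lamDel ^ n) (applyShift (H j i)
        (((-lamDel) ^ m) (Polynomial.C (MvPolynomial.pderiv (i, m) f))))

variable {𝔤 : Type*} [LieRing 𝔤] [LieAlgebra F 𝔤]

/-- An element `a ∈ 𝔤` as an element of `𝒱(𝔤) = S(F[∂]𝔤)`, the algebra of differential polynomials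
in the elements of a basis of `𝔤`. -/
def lin [Fintype ι] (b : Module.Basis ι F 𝔤) (a : 𝔤) : DiffPoly F ι :=
  ∑ i : ι, b.repr a i • MvPolynomial.X (i, 0)

/-- The lambda-bracket of the affine Poisson vertex algebra `𝒱(𝔤, κ, s)`, with
`{a_λ b} = [a, b] + κ(s | [a, b]) + κ(a | b) λ` for `a, b ∈ 𝔤`. -/
def affineBracket [Fintype ι] (κ : LinearMap.BilinForm F 𝔤) (b : Module.Basis ι F 𝔤) (s : 𝔤)
    (f g : DiffPoly F ι) : Polynomial (DiffPoly F ι) :=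
  masterBracket (fun j i =>
    Polynomial.C (lin b ⁅b i, b j⁆ + MvPolynomial.C (κ s ⁅b i, b j⁆)) +
      Polynomial.C (MvPolynomial.C (κ (b i) (b j))) * Polynomial.X) f g

/-! ### The grading of `𝔤` and the subalgebras `𝔪 ⊆ 𝔫` -/

/-- For `h = 2x`, the `ad x`-eigenspace `𝔤_{k/2}` of eigenvalue `k/2`, `k ∈ ℤ`. -/
def grade (h : 𝔤) (k : ℤ) : Submodule F 𝔤 :=
  Module.End.eigenspace (LieAlgebra.ad F 𝔤 ((2 : F)⁻¹ • h)) ((k : F) / 2)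

/-- The sum of the `𝔤_{k/2}` with `k > j`. -/
def gradeGT (h : 𝔤) (j : ℤ) : Submodule F 𝔤 := ⨆ k : {k : ℤ // j < k}, grade h k

/-- The sum of the `𝔤_{k/2}` with `k ≤ j`. -/
def gradeLE (h : 𝔤) (j : ℤ) : Submodule F 𝔤 := ⨆ k : {k : ℤ // k ≤ j}, grade h k

/-- The complement `{a ∈ 𝔤_{1/2} | κ(f | [a, b]) = 0 for all b ∈ 𝔩}`, with respect to the form
`ω(a, b) = κ(f | [a, b])`. -/
def lPerp (κ : LinearMap.BilinForm F 𝔤) (h f : 𝔤) (l : Submodule F 𝔤) : Submodule F 𝔤 where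
  carrier := {a | a ∈ grade (F := F) h 1 ∧ ∀ b ∈ l, κ f ⁅a, b⁆ = 0}
  add_mem' := fun ha hb =>
    ⟨add_mem ha.1 hb.1, fun c hc => by simp [add_lie, ha.2 c hc, hb.2 c hc]⟩
  zero_mem' := ⟨zero_mem _, fun c _ => by simp⟩
  smul_mem' := fun t _ ha =>
    ⟨Submodule.smul_mem _ t ha.1, fun c hc => by simp [smul_lie, ha.2 c hc]⟩

/-- `𝔪 = 𝔩 ⊕ 𝔤_{≥1}`. -/
def mSub (h : 𝔤) (l : Submodule F 𝔤) : Submodule F 𝔤 := l ⊔ gradeGT h 1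

/-- `𝔫 = 𝔩^{⊥ω} ⊕ 𝔤_{≥1}`. -/
def nSub (κ : LinearMap.BilinForm F 𝔤) (h f : 𝔤) (l : Submodule F 𝔤) : Submodule F 𝔤 :=
  lPerp κ h f l ⊔ gradeGT h 1

/-- The data from which a classical W-algebra is built: a non-degenerate symmetric invariant form
`κ`, an `sl₂`-triple `(f, h = 2x, e)`, an isotropic subspace `𝔩 ⊆ 𝔤_{1/2}`, a complement
`𝔭 ⊆ 𝔤_{≤1/2}` of `𝔪`, an element `s` commuting with `𝔫`, and a basis of `𝔤` made of a basis
`q_i = b (inl i)` of `𝔭` and a basis of `𝔪`. -/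
structure WData (F 𝔤 P M : Type*) [Field F] [LieRing 𝔤] [LieAlgebra F 𝔤] where
  κ : LinearMap.BilinForm F 𝔤
  κ_symm : ∀ a b, κ a b = κ b a
  κ_inv : ∀ a b c, κ ⁅a, b⁆ c = κ a ⁅b, c⁆
  κ_nondeg : κ.Nondegenerate
  e : 𝔤
  h : 𝔤
  f : 𝔤
  sl2 : IsSl2Triple h e f
  l : Submodule F 𝔤
  l_le : l ≤ grade h 1
  l_isotropic : ∀ a ∈ l, ∀ b ∈ l, κ f ⁅a, b⁆ = 0
  p : Submodule F 𝔤
  p_le : p ≤ gradeLE h 1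
  compl : IsCompl (mSub h l) p
  s : 𝔤
  s_comm : ∀ a ∈ nSub κ h f l, ⁅s, a⁆ = 0
  b : Module.Basis (P ⊕ M) F 𝔤
  b_inl : ∀ i, b (Sum.inl i) ∈ p
  b_inr : ∀ j, b (Sum.inr j) ∈ mSub h l

/-! ### Laurent series in `z⁻¹` -/

/-- `A((z⁻¹))`: Mathlib's Laurent series over `A`, whose variable stands for `z⁻¹`. So the
coefficient of index `n` is that of `z^{-n}`. -/
def Laur (A : Type*) [CommRing A] : Type _ := LaurentSeries A

instance {A : Type*} [CommRing A] : CommRing (Laur A) :=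
  inferInstanceAs (CommRing (HahnSeries ℤ A))

instance {R A : Type*} [CommRing R] [CommRing A] [Algebra R A] : Algebra R (Laur A) :=
  (HahnSeries.instAlgebra : Algebra R (HahnSeries ℤ A))

section Laurent

variable {A B : Type*} [CommRing A] [Algebra F A] [CommRing B] [Algebra F B]

/-- The Laurent series `a z^{-n}`. -/
def mono (n : ℤ) (a : A) : Laur A := (HahnSeries.single n a : HahnSeries ℤ A)

variable (F A) in
/-- The coefficient of `z^{-n}`. -/
def coeffL (n : ℤ) : Laur A →ₗ[F] A where
  toFun x := HahnSeries.coeff (x : HahnSeries ℤ A) n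
  map_add' _ _ := rfl
  map_smul' _ _ := rfl

/-- Coefficientwise application of a linear map to Laurent series. -/
def mapL (φ : A →ₗ[F] B) : Laur A →ₗ[F] Laur B where
  toFun x := HahnSeries.map (x : HahnSeries ℤ A) φ
  map_add' x y := HahnSeries.ext (funext fun n => map_add φ (coeffL F A n x) (coeffL F A n y))
  map_smul' c x := HahnSeries.ext (funext fun n => map_smul φ c (coeffL F A n x))

variable (F 𝔤 A) in
/-- The coefficient of `z^{-n}` of an element of `(𝔤 ⊗ A)((z⁻¹))`. As `𝔤` is finite-dimensional,
this space of Laurent series is `A((z⁻¹)) ⊗ 𝔤`; in particular `𝔤((z⁻¹))` is `F((z⁻¹)) ⊗ 𝔤`. -/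
def coeffZ (n : ℤ) : Laur A ⊗[F] 𝔤 →ₗ[F] A ⊗[F] 𝔤 :=
  LinearMap.rTensor 𝔤 (coeffL F A n)

variable (F 𝔤) in
/-- The coefficient of `z^{-n}` of an element of `𝔤((z⁻¹))`. -/
def coeffG (n : ℤ) : Laur F ⊗[F] 𝔤 →ₗ[F] 𝔤 :=
  (TensorProduct.lid F 𝔤).toLinearMap ∘ₗ coeffZ F 𝔤 F n

/-- For `z` of degree `-m-1` with `m = d/2`: the space `𝔤((z⁻¹))_{>k/2}` of Laurent series all of
whose homogeneous components have degree `> k/2`. (If `a ∈ 𝔤_{j/2}`, then `a z^{-n}` has degree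
`(j + n (d + 2)) / 2`.) -/
def gzGT (h : 𝔤) (d k : ℤ) : Submodule F (Laur F ⊗[F] 𝔤) :=
  ⨅ n : ℤ, (gradeGT h (k - n * (d + 2))).comap (coeffG F 𝔤 n)

variable (A) in
/-- The completed tensor product of a subspace `W ⊆ 𝔤((z⁻¹))` with `A`, inside `(𝔤 ⊗ A)((z⁻¹))`:
those series all of whose contractions with linear forms on `A` lie in `W`. -/
def extendSub (W : Submodule F (Laur F ⊗[F] 𝔤)) : Submodule F (Laur A ⊗[F] 𝔤) :=
  ⨅ φ : Module.Dual F A, W.comap (LinearMap.rTensor 𝔤 (mapL φ))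

/-- `a(z) ↦ a(z) ⊗ 1`. -/
def tensorOne : Laur F ⊗[F] 𝔤 →ₗ[F] Laur A ⊗[F] 𝔤 :=
  LinearMap.rTensor 𝔤 (mapL (Algebra.linearMap F A))

theorem mapL_derivation_mul (δ : Derivation F A A) (x y : Laur A) :
    mapL δ.toLinearMap (x * y) =
      x * mapL δ.toLinearMap y + mapL δ.toLinearMap x * y := by
  let x' : HahnSeries ℤ A := x
  let y' : HahnSeries ℤ A := y
  have hsub : ∀ u : HahnSeries ℤ A,
      (HahnSeries.map u δ.toLinearMap).support ⊆ u.support := fun u n hn hu =>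
    hn (by change δ (u.coeff n) = 0; rw [hu, map_zero])
  change HahnSeries.map (x' * y') δ.toLinearMap =
    x' * HahnSeries.map y' δ.toLinearMap + HahnSeries.map x' δ.toLinearMap * y'
  ext1
  funext n
  change δ ((x' * y').coeff n) = _
  rw [HahnSeries.coeff_add, HahnSeries.coeff_mul,
    HahnSeries.coeff_mul_right' y'.isPWO_support (hsub y'),
    HahnSeries.coeff_mul_left' x'.isPWO_support (hsub x'), map_sum, ← Finset.sum_add_distrib]
  refine Finset.sum_congr rfl fun ij _ => ?_
  rw [Derivation.leibniz, smul_eq_mul, smul_eq_mul, mul_comm (y'.coeff _)]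
  rfl

/-- A derivation of `A`, acting on the `A`-coefficients, as a derivation of the Lie algebra
`(𝔤 ⊗ A)((z⁻¹))`, in which `[a ⊗ u, b ⊗ v] = [a, b] ⊗ uv`. -/
def coeffDer (δ : Derivation F A A) : LieDerivation F (Laur A ⊗[F] 𝔤) (Laur A ⊗[F] 𝔤) where
  toLinearMap := LinearMap.rTensor 𝔤 (mapL δ.toLinearMap)
  leibniz' x y := by
    induction x using TensorProduct.induction_on with
    | zero => simp
    | add x x' hx hx' =>
      simp only [add_lie, lie_add, map_add, hx, hx']
      abel
    | tmul u a =>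
      induction y using TensorProduct.induction_on with
      | zero => simp
      | add y y' hy hy' =>
        simp only [add_lie, lie_add, map_add, hy, hy']
        abel
      | tmul v c =>
        simp only [LieAlgebra.ExtendScalars.bracket_tmul, LinearMap.rTensor_tmul,
          mapL_derivation_mul]
        rw [← lie_skew c a, TensorProduct.tmul_neg, sub_neg_eq_add, ← TensorProduct.add_tmul,
          mul_comm v]

end Laurent

/-! ### The Lie algebra `F∂ ⋉ (𝔤 ⊗ 𝒱)((z⁻¹))` -/

/-- The one-dimensional (abelian) Lie algebra `F∂`; the scalar `c` stands for `c∂`. -/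
def FDel (F : Type*) [Field F] : Type _ := F

instance : AddCommGroup (FDel F) := inferInstanceAs (AddCommGroup F)

instance : Module F (FDel F) := inferInstanceAs (Module F F)

instance : LieRing (FDel F) where
  bracket _ _ := 0
  add_lie _ _ _ := (add_zero _).symm
  lie_add _ _ _ := (add_zero _).symm
  lie_self _ := rfl
  leibniz_lie _ _ _ := (add_zero _).symm

instance : LieAlgebra F (FDel F) where
  lie_smul c _ _ := (smul_zero c).symm

/-- The basis element `∂`. -/
def FDel.one : FDel F := (1 : F)

/-- `(𝔤 ⊗ 𝒱)((z⁻¹))` for `𝒱` the differential polynomials in variables indexed by `ι`. -/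
abbrev GV (F 𝔤 ι : Type*) [Field F] [LieRing 𝔤] [LieAlgebra F 𝔤] : Type _ :=
  Laur (DiffPoly F ι) ⊗[F] 𝔤

/-- The action of `F∂` on `(𝔤 ⊗ 𝒱)((z⁻¹))`: `c∂` acts as `c` times the derivation `∂`. -/
def delAction : FDel F →ₗ⁅F⁆ LieDerivation F (GV F 𝔤 ι) (GV F 𝔤 ι) where
  toFun c := (show F from c) • coeffDer del
  map_add' c c' := add_smul (show F from c) (show F from c') _
  map_smul' c c' := mul_smul c (show F from c') _
  map_lie' {c c'} := by
    rw [lie_smul, smul_lie, lie_self, smul_zero, smul_zero]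
    exact zero_smul F _

/-- The semidirect product `F∂ ⋉ (𝔤 ⊗ 𝒱)((z⁻¹))`; `⟨A, c⟩` is `c∂ + A`. -/
abbrev DelGV (F 𝔤 ι : Type*) [Field F] [LieRing 𝔤] [LieAlgebra F 𝔤] : Type _ :=
  LieAlgebra.SemiDirectSum (GV F 𝔤 ι) (FDel F) (delAction (F := F) (𝔤 := 𝔤) (ι := ι))

/-- `Y = e^{ad U} X`: the partial sums of `∑_k (ad U)^k X / k!` converge to `Y`, every coefficient
of every power of `z` being eventually constant. -/
def IsExpAd (U : GV F 𝔤 ι) (X Y : DelGV F 𝔤 ι) : Prop :=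
  ∀ n : ℤ, ∀ᶠ K : ℕ in Filter.atTop,
    let S := ∑ k ∈ Finset.range K, ((k.factorial : F)⁻¹) •
      ((LieAlgebra.ad F (DelGV F 𝔤 ι) (LieAlgebra.SemiDirectSum.inl _ U)) ^ k) X
    S.right = Y.right ∧ coeffZ F 𝔤 (DiffPoly F ι) n S.left = coeffZ F 𝔤 (DiffPoly F ι) n Y.left

/-- The quotient map `∫ : 𝒱 → 𝒱/∂𝒱`, applied to the coefficients of Laurent series. -/
def intZ (x : Laur (DiffPoly F ι)) :
    LaurentSeries (DiffPoly F ι ⧸ LinearMap.range (del (F := F) (ι := ι)).toLinearMap) :=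
  HahnSeries.map (x : HahnSeries ℤ (DiffPoly F ι))
    (Submodule.mkQ (LinearMap.range (del (F := F) (ι := ι)).toLinearMap))

/-- The `𝒱((z⁻¹))`-bilinear extension `κ(a ⊗ u | b ⊗ v) = κ(a | b) u v`. -/
def kappaZ (κ : LinearMap.BilinForm F 𝔤) (x y : GV F 𝔤 ι) : Laur (DiffPoly F ι) :=
  LinearMap.BilinForm.baseChange (Laur (DiffPoly F ι)) κ x y

namespace WData

variable {P M : Type*} (D : WData F 𝔤 P M)

/-- The element `π_𝔭(a) ∈ 𝔭 ⊆ 𝒱(𝔭)`, where `π_𝔭` is the projection with kernel `𝔪`. -/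
def linP [Fintype P] (a : 𝔤) : DiffPoly F P :=
  ∑ i : P, D.b.repr a (Sum.inl i) • MvPolynomial.X (i, 0)

/-- The differential algebra homomorphism `ρ : 𝒱(𝔤) → 𝒱(𝔭)` with `ρ(a) = π_𝔭(a) + κ(f | a)` for
`a ∈ 𝔤`. -/
def rho [Fintype P] : DiffPoly F (P ⊕ M) →ₐ[F] DiffPoly F P :=
  MvPolynomial.aeval fun v =>
    (del : Derivation F (DiffPoly F P) (DiffPoly F P))^[v.2]
      (D.linP (D.b v.1) + MvPolynomial.C (D.κ D.f (D.b v.1)))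

/-- The inclusion `𝒱(𝔭) ⊆ 𝒱(𝔤)`. -/
def incl : DiffPoly F P →ₐ[F] DiffPoly F (P ⊕ M) :=
  MvPolynomial.rename fun v => (Sum.inl v.1, v.2)

/-- The space `𝒲 = {g ∈ 𝒱(𝔭) | ρ{a_λ g}_z = 0 for all a ∈ 𝔫}`, where `{·_λ ·}_z` is the bracket of
`𝒱(𝔤, κ, zs)`, `z ∈ F` (`𝒲` does not depend on `z`). -/
def W [Fintype P] [Fintype M] (z : F) : Set (DiffPoly F P) :=
  {g | ∀ a ∈ nSub D.κ D.h D.f D.l,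
    (affineBracket D.κ D.b (z • D.s) (lin D.b a) (incl (M := M) g)).map
      (D.rho : DiffPoly F (P ⊕ M) →+* DiffPoly F P) = 0}

/-- `f + zs ∈ 𝔤((z⁻¹))`. -/
def fzs : Laur F ⊗[F] 𝔤 := 1 ⊗ₜ D.f + mono (-1) 1 ⊗ₜ D.s

/-- `𝔥 = Ker ad(f + zs) ⊆ 𝔤((z⁻¹))`. -/
def hSub : Submodule (Laur F) (Laur F ⊗[F] 𝔤) :=
  LinearMap.ker (LieAlgebra.ad (Laur F) (Laur F ⊗[F] 𝔤) D.fzs)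

/-- `Im ad(f + zs) ⊆ 𝔤((z⁻¹))`. -/
def imSub : Submodule (Laur F) (Laur F ⊗[F] 𝔤) :=
  LinearMap.range (LieAlgebra.ad (Laur F) (Laur F ⊗[F] 𝔤) D.fzs)

/-- The centre `Z(𝔥)`. -/
def hCenter : Set (Laur F ⊗[F] 𝔤) := {a | a ∈ D.hSub ∧ ∀ c ∈ D.hSub, ⁅a, c⁆ = 0}

/-- The basis `q^i` of `𝔪^⊥` dual to the basis `q_i` of `𝔭`: the element of `𝔤` with
`κ(q^i | q_j) = δ_{ij}` and `κ(q^i | 𝔪) = 0`. -/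
def qDual [Finite P] [Finite M] (i : P) : 𝔤 :=
  open Classical in D.κ.dualBasis D.κ_nondeg D.b (Sum.inl i)

/-- `L(z) = ∂ + q + (f + zs) ⊗ 1`, where `q = ∑ q^i ⊗ q_i`. -/
def L [Fintype P] [Finite M] : DelGV F 𝔤 P :=
  ⟨(∑ i : P, mono 0 (MvPolynomial.X (i, 0)) ⊗ₜ D.qDual i) + tensorOne D.fzs, FDel.one⟩

/-- `[L(z), x]` for `x ∈ (𝔤 ⊗ 𝒱(𝔭))((z⁻¹))`; the bracket is taken in `F∂ ⋉ (𝔤 ⊗ 𝒱(𝔭))((z⁻¹))` and has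
no `∂`-component. -/
def lieL [Fintype P] [Finite M] (x : GV F 𝔤 P) : GV F 𝔤 P :=
  (⁅D.L, LieAlgebra.SemiDirectSum.inl _ x⁆ : DelGV F 𝔤 P).left

/-- The variational derivative `δg(z)/δq = ∑ q_i ⊗ δg(z)/δq_i`. -/
def varDerZ [Fintype P] (g : Laur (DiffPoly F P)) : GV F 𝔤 P :=
  ∑ i : P, mapL (varDer i) g ⊗ₜ D.b (Sum.inl i)

/-- `U(z), h(z)` solve `e^{ad U(z)} L(z) = ∂ + (f + zs) ⊗ 1 + h(z)`, with `U(z)` in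
`𝔤((z⁻¹))_{>0} ⊗ 𝒱(𝔭)` and `h(z)` in `𝔥_{>-1} ⊗ 𝒱(𝔭)` (completed); `d/2` is the degree of `s`. -/
def IsSolution [Fintype P] [Finite M] (d : ℤ) (U hz : GV F 𝔤 P) : Prop :=
  U ∈ extendSub (DiffPoly F P) (gzGT D.h d 0) ∧
  hz ∈ extendSub (DiffPoly F P) (D.hSub.restrictScalars F ⊓ gzGT D.h d (-2)) ∧
  IsExpAd U D.L ⟨tensorOne D.fzs + hz, FDel.one⟩

end WData

end DSW

end

/-!
The functional `Φ(x) = ∫ κ(a(z) ⊗ 1 | e^{ad U(z)} x)` on `(𝔤 ⊗ 𝒱(𝔭))((z⁻¹))` carries the argument.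

* `Φ` vanishes on the image of `ad L(z)`: the homomorphism `e^{ad U}` turns `[L, y]` into
  `[∂ + (f + zs) ⊗ 1 + h(z), e^{ad U} y]`, and `a(z) ⊗ 1` commutes with `(f + zs) ⊗ 1` and with
  `h(z)`, so that only a total derivative is left (`IsDressing.asympNull_lieL`).
* `Φ` computes variations: for an evolutionary vector field `X`, applying `e^{ad U}` to
  `[X, L] = X(L)` in the semidirect product with all derivations, where `e^{ad U} X = X + η`, gives
  `Φ(X(L)) = X ∫ κ(a ⊗ 1 | h(z)) = X ∫ g` (`IsDressing.asympNull_variation`). So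
  `∫ ∑ δg/δq_i Q_i = Φ(∑ q^i ⊗ Q_i)` (`IsDressing.asympNull_varDer`).
* For `p ∈ 𝒲`, the defining equation `ρ{a_λ p} = 0`, evaluated at `λ^k ↦ ∂^k w`, says that `p` is
  invariant under the infinitesimal gauge transformations `q ↦ [L, a ⊗ w]`, `a ∈ 𝔫`
  (`evol_gaugeVar_eq_zero`); integrating by parts, `x = [L, δp/δq]` satisfies
  `∫ κ(a ⊗ w | x) = 0` for `a ∈ 𝔫` (`kappaZ_tmul_lieL_varDerZ_mem`).

By skew-adjointness of `ad L` the claim is `∫ κ(δg/δq | x) = 0`, and the left side equals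
`Φ(∑ q^i ⊗ κ(q_i | x))`. The argument of `Φ` is the component of `x` in `𝔪^⊥` along `𝔭^⊥`; it
differs from `x = [L, δp/δq]`, on which `Φ` vanishes, by `∑ b^j ⊗ κ(b_j | x)` for a basis `(b_j)` of
`𝔪 ⊆ 𝔫`, on which `Φ` vanishes by gauge invariance, being linear over `𝒱(𝔭)((z⁻¹))` before
integration (`IsDressing.kappaZ_lieL_varDerZ_mem`).

Infinite sums are avoided: `e^{ad U}` is replaced by its truncations, and all identities are proved
modulo terms of high degree (`IsLieFiltration.expAd_lie_sub_mem`, `AsympNull`). This needs `z` to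
have negative degree. The decomposition of `𝔤((z⁻¹))` forces `s ≠ 0`, and then `s` is a highest
weight vector for the `sl₂`-triple, so its degree is nonnegative (`degree_nonneg`).
-/

noncomputable section

namespace DSW

/-! ### Laurent series and total derivatives -/

section Laurent

variable {F A B : Type*} [Field F] [CommRing A] [Algebra F A] [CommRing B] [Algebra F B]

variable (F) in
theorem laur_ext {x y : Laur A} (h : ∀ n, coeffL F A n x = coeffL F A n y) : x = y :=
  HahnSeries.ext (funext h)

@[simp] theorem coeffL_mapL (φ : A →ₗ[F] B) (x : Laur A) (n : ℤ) :
    coeffL F B n (mapL φ x) = φ (coeffL F A n x) := rfl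

theorem coeffL_mono (m n : ℤ) (a : A) :
    coeffL F A m (mono n a) = if m = n then a else 0 := by
  split_ifs with h
  · rw [h]; exact HahnSeries.coeff_single_same n a
  · exact HahnSeries.coeff_single_of_ne h

theorem coeffL_mono_mul (m n : ℤ) (a : A) (x : Laur A) :
    coeffL F A m (mono n a * x) = a * coeffL F A (m - n) x := by
  have h := HahnSeries.coeff_single_mul_add (r := a) (x := (x : HahnSeries ℤ A)) (a := m - n)
    (b := n)
  rw [sub_add_cancel] at h
  exact h

theorem mono_mul_mono (m n : ℤ) (a b : A) : mono m a * mono n b = mono (m + n) (a * b) :=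
  HahnSeries.single_mul_single

theorem mono_zero_one : mono 0 (1 : A) = 1 := rfl

variable (F A) in
/-- `a ↦ a z^{-n}` as a linear map. -/
def monoLin (n : ℤ) : A →ₗ[F] Laur A where
  toFun := mono n
  map_add' a b := laur_ext F fun m => by
    rw [map_add, coeffL_mono, coeffL_mono, coeffL_mono]; split_ifs <;> simp
  map_smul' c a := laur_ext F fun m => by
    rw [map_smul, coeffL_mono, coeffL_mono]; split_ifs <;> simp

theorem monoLin_apply (n : ℤ) (a : A) : monoLin F A n a = mono n a := rfl

theorem mapL_mono (φ : A →ₗ[F] B) (n : ℤ) (a : A) : mapL φ (mono n a) = mono n (φ a) :=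
  laur_ext F fun m => by
    rw [coeffL_mapL, coeffL_mono, coeffL_mono]; split_ifs <;> simp

/-- Coefficientwise application of a linear map is linear over the series with constant
coefficients. -/
theorem mapL_const_mul (φ : A →ₗ[F] B) (x : Laur F) (y : Laur A) :
    mapL φ (mapL (Algebra.linearMap F A) x * y) = mapL (Algebra.linearMap F B) x * mapL φ y := by
  let x' : HahnSeries ℤ F := x
  let y' : HahnSeries ℤ A := y
  have hxA : (HahnSeries.map x' (Algebra.linearMap F A)).support ⊆ x'.support := fun n hn hu =>
    hn (by change Algebra.linearMap F A (x'.coeff n) = 0; rw [hu, map_zero])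
  have hy : (HahnSeries.map y' φ).support ⊆ y'.support := fun n hn hu =>
    hn (by change φ (y'.coeff n) = 0; rw [hu, map_zero])
  change HahnSeries.map (HahnSeries.map x' (Algebra.linearMap F A) * y') φ =
    HahnSeries.map x' (Algebra.linearMap F B) * HahnSeries.map y' φ
  ext1
  funext n
  change φ ((HahnSeries.map x' (Algebra.linearMap F A) * y').coeff n) = _
  have hxB : (HahnSeries.map x' (Algebra.linearMap F B)).support ⊆ x'.support := fun n hn hu =>
    hn (by change Algebra.linearMap F B (x'.coeff n) = 0; rw [hu, map_zero])
  have hl : ((HahnSeries.map x' (Algebra.linearMap F A)) * y').coeff n =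
      ∑ ij ∈ Finset.antidiagonal x'.isPWO_support y'.isPWO_support n,
        algebraMap F A (x'.coeff ij.1) * y'.coeff ij.2 :=
    HahnSeries.coeff_mul_left' x'.isPWO_support hxA
  have hr : (HahnSeries.map x' (Algebra.linearMap F B) * HahnSeries.map y' φ).coeff n =
      ∑ ij ∈ Finset.antidiagonal x'.isPWO_support y'.isPWO_support n,
        algebraMap F B (x'.coeff ij.1) * φ (y'.coeff ij.2) := by
    rw [HahnSeries.coeff_mul]
    refine Finset.sum_subset_zero_on_sdiff
      (Finset.antidiagonal_mono_left hxB |>.trans (Finset.antidiagonal_mono_right hy)) ?_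
      fun ij _ => rfl
    intro ij hij
    rw [Finset.mem_sdiff, Finset.mem_antidiagonal, Finset.mem_antidiagonal] at hij
    by_contra h
    exact hij.2 ⟨left_ne_zero_of_mul h, right_ne_zero_of_mul h, hij.1.2.2⟩
  rw [hl, hr, map_sum]
  refine Finset.sum_congr rfl fun ij _ => ?_
  rw [← Algebra.smul_def, map_smul, Algebra.smul_def]

variable (F A) in
/-- If `z` has degree `-D/2`, the scalar series in `A((z⁻¹))` of degree at least `N/2`. -/
def ordGE (D N : ℤ) : Submodule F (Laur A) where
  carrier := {x | ∀ n : ℤ, n * D < N → coeffL F A n x = 0}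
  add_mem' hx hy n hn := by rw [map_add, hx n hn, hy n hn, add_zero]
  zero_mem' n _ := map_zero _
  smul_mem' c x hx n hn := by rw [map_smul, hx n hn, smul_zero]

theorem ordGE_anti (D : ℤ) {M N : ℤ} (h : M ≤ N) : ordGE F A D N ≤ ordGE F A D M :=
  fun _ hx n hn => hx n (hn.trans_le h)

theorem mul_mem_ordGE {D M N : ℤ} {x y : Laur A} (hx : x ∈ ordGE F A D M)
    (hy : y ∈ ordGE F A D N) : x * y ∈ ordGE F A D (M + N) := by
  let x' : HahnSeries ℤ A := x
  let y' : HahnSeries ℤ A := y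
  intro n hn
  change (x' * y').coeff n = 0
  rw [HahnSeries.coeff_mul]
  refine Finset.sum_eq_zero fun ij hij => ?_
  have h : ij.1 + ij.2 = n := (Finset.mem_antidiagonal.1 hij).2.2
  rw [← h, add_mul] at hn
  rcases lt_or_ge (ij.1 * D) M with h1 | h1
  · have := hx _ h1
    change x'.coeff ij.1 = 0 at this
    rw [this, zero_mul]
  · have := hy ij.2 (by linarith)
    change y'.coeff ij.2 = 0 at this
    rw [this, mul_zero]

theorem exists_mem_ordGE {D : ℤ} (hD : 0 < D) (x : Laur A) : ∃ N, x ∈ ordGE F A D N := by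
  by_cases hx : (x : HahnSeries ℤ A) = 0
  · exact ⟨0, by rw [show x = 0 from hx]; exact zero_mem _⟩
  · refine ⟨HahnSeries.order (x : HahnSeries ℤ A) * D, fun n hn => ?_⟩
    exact HahnSeries.coeff_eq_zero_of_lt_order (lt_of_mul_lt_mul_right hn hD.le)

theorem mapL_mem_ordGE (φ : A →ₗ[F] B) {D N : ℤ} {x : Laur A} (hx : x ∈ ordGE F A D N) :
    mapL φ x ∈ ordGE F B D N := fun n hn => by rw [coeffL_mapL, hx n hn, map_zero]

end Laurent

section TotalDerivatives

variable {F ι : Type*} [Field F]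

variable (F ι) in
/-- The Laurent series whose coefficients are total derivatives, that is, the kernel of `∫`. -/
def totalDer : Submodule F (Laur (DiffPoly F ι)) where
  carrier := {x | ∀ n, coeffL F _ n x ∈ LinearMap.range (del (F := F) (ι := ι)).toLinearMap}
  add_mem' hx hy n := by rw [map_add]; exact add_mem (hx n) (hy n)
  zero_mem' n := by rw [map_zero]; exact zero_mem _
  smul_mem' c x hx n := by rw [map_smul]; exact Submodule.smul_mem _ c (hx n)

theorem intZ_eq_zero_iff (x : Laur (DiffPoly F ι)) : intZ x = 0 ↔ x ∈ totalDer F ι := by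
  constructor
  · intro h n
    have := congrArg (fun y => HahnSeries.coeff y n) h
    exact (Submodule.Quotient.mk_eq_zero _).1 this
  · intro h
    refine HahnSeries.ext (funext fun n => ?_)
    exact (Submodule.Quotient.mk_eq_zero _).2 (h n)

theorem intZ_eq_iff (x y : Laur (DiffPoly F ι)) : intZ x = intZ y ↔ x - y ∈ totalDer F ι := by
  constructor
  · intro h n
    have := congrArg (fun y => HahnSeries.coeff y n) h
    exact (Submodule.Quotient.eq _).1 this
  · intro h
    refine HahnSeries.ext (funext fun n => ?_)
    exact (Submodule.Quotient.eq _).2 (h n)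

theorem mapL_del_mem (x : Laur (DiffPoly F ι)) : mapL del.toLinearMap x ∈ totalDer F ι :=
  fun n => ⟨coeffL F _ n x, rfl⟩

theorem mono_mul_mem_totalDer {x : Laur (DiffPoly F ι)} (hx : x ∈ totalDer F ι) (n : ℤ) :
    mono n 1 * x ∈ totalDer F ι := fun m => by
  rw [coeffL_mono_mul, one_mul]; exact hx _

theorem mapL_mem_totalDer (X : Derivation F (DiffPoly F ι) (DiffPoly F ι))
    (hX : ∀ u, X (del u) = del (X u)) {x : Laur (DiffPoly F ι)} (hx : x ∈ totalDer F ι) :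
    mapL X.toLinearMap x ∈ totalDer F ι := fun n => by
  obtain ⟨u, hu⟩ := hx n
  refine ⟨X u, ?_⟩
  rw [coeffL_mapL, ← hu]
  exact (hX u).symm

/-- A series is a total derivative as soon as it is one up to terms of arbitrarily high degree. -/
theorem mem_totalDer_of_forall {D : ℤ} {x : Laur (DiffPoly F ι)}
    (h : ∀ N, x ∈ totalDer F ι ⊔ ordGE F (DiffPoly F ι) D N) : x ∈ totalDer F ι := by
  intro n
  obtain ⟨y, hy, w, hw, rfl⟩ := Submodule.mem_sup.1 (h (n * D + 1))
  rw [map_add, hw n (lt_add_one _), add_zero]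
  exact hy n

end TotalDerivatives

/-! ### Truncated exponentials in a filtered Lie algebra -/

section TruncatedExp

variable {F L : Type*} [Field F] [LieRing L] [LieAlgebra F L]

variable (F) in
/-- The truncated exponential `∑_{k < K} (ad U)^k / k!`. -/
def expAd (U : L) (K : ℕ) : L →ₗ[F] L :=
  ∑ k ∈ Finset.range K, (k.factorial : F)⁻¹ • (LieAlgebra.ad F L U) ^ k

theorem expAd_apply (U : L) (K : ℕ) (x : L) :
    expAd F U K x = ∑ k ∈ Finset.range K, (k.factorial : F)⁻¹ • ((LieAlgebra.ad F L U) ^ k) x := by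
  simp [expAd, LinearMap.sum_apply]

theorem inv_factorial_smul_ad_pow_lie [CharZero F] (U x y : L) (k : ℕ) :
    (k.factorial : F)⁻¹ • ((LieAlgebra.ad F L U) ^ k) ⁅x, y⁆ =
      ∑ ij ∈ Finset.HasAntidiagonal.antidiagonal k,
        ⁅(ij.1.factorial : F)⁻¹ • ((LieAlgebra.ad F L U) ^ ij.1) x,
          (ij.2.factorial : F)⁻¹ • ((LieAlgebra.ad F L U) ^ ij.2) y⁆ := by
  rw [LieAlgebra.ad_pow_lie, Finset.smul_sum]
  refine Finset.sum_congr rfl fun ij hij => ?_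
  rw [lie_smul, smul_lie, smul_smul, ← Nat.cast_smul_eq_nsmul F, smul_smul]
  congr 1
  rw [← Finset.HasAntidiagonal.mem_antidiagonal.1 hij, Nat.cast_add_choose]
  have h0 : ((ij.1 + ij.2).factorial : F) ≠ 0 := by exact_mod_cast Nat.factorial_ne_zero _
  field_simp

/-- A decreasing filtration of a Lie algebra with `[fil i, fil j] ⊆ fil (i + j)`. -/
structure IsLieFiltration (fil : ℤ → Submodule F L) : Prop where
  anti : Antitone fil
  lie_mem : ∀ {i j x y}, x ∈ fil i → y ∈ fil j → ⁅x, y⁆ ∈ fil (i + j)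

namespace IsLieFiltration

variable {fil : ℤ → Submodule F L}

theorem ad_pow_mem (hfil : IsLieFiltration fil) {U x : L} (hU : U ∈ fil 1) {i : ℤ}
    (hx : x ∈ fil i) (n : ℕ) :
    (n.factorial : F)⁻¹ • ((LieAlgebra.ad F L U) ^ n) x ∈ fil (n + i) := by
  refine Submodule.smul_mem _ _ ?_
  induction n with
  | zero => simpa using hx
  | succ n ih =>
    rw [pow_succ', Module.End.mul_apply, LieAlgebra.ad_apply]
    have := hfil.lie_mem hU ih
    rwa [show (1 : ℤ) + (n + i) = ((n + 1 : ℕ) : ℤ) + i by push_cast; ring] at this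

theorem expAd_mem (hfil : IsLieFiltration fil) {U x : L} (hU : U ∈ fil 1) {i : ℤ}
    (hx : x ∈ fil i) (K : ℕ) :
    expAd F U K x ∈ fil i := by
  rw [expAd_apply]
  exact Submodule.sum_mem _ fun n _ =>
    hfil.anti (by linarith [Int.natCast_nonneg n]) (hfil.ad_pow_mem hU hx n)

theorem expAd_sub_expAd_mem (hfil : IsLieFiltration fil) {U x : L} (hU : U ∈ fil 1) {i : ℤ}
    (hx : x ∈ fil i) {K K' : ℕ}
    (h : K ≤ K') : expAd F U K' x - expAd F U K x ∈ fil (K + i) := by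
  rw [expAd_apply, expAd_apply, ← Finset.sum_sdiff_eq_sub (Finset.range_mono h)]
  refine Submodule.sum_mem _ fun n hn => hfil.anti ?_ (hfil.ad_pow_mem hU hx n)
  have : (K : ℤ) ≤ n := by simpa using (Finset.mem_sdiff.1 hn).2
  linarith

/-- The truncated exponential of `ad U` is a Lie algebra homomorphism up to high filtration. -/
theorem expAd_lie_sub_mem [CharZero F] (hfil : IsLieFiltration fil) {U x y : L} (hU : U ∈ fil 1)
    {i j : ℤ} (hx : x ∈ fil i)
    (hy : y ∈ fil j) (K : ℕ) :
    ⁅expAd F U K x, expAd F U K y⁆ - expAd F U K ⁅x, y⁆ ∈ fil (K + i + j) := by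
  classical
  set f : ℕ × ℕ → L := fun ij => ⁅(ij.1.factorial : F)⁻¹ • ((LieAlgebra.ad F L U) ^ ij.1) x,
    (ij.2.factorial : F)⁻¹ • ((LieAlgebra.ad F L U) ^ ij.2) y⁆ with hf
  have h1 : ⁅expAd F U K x, expAd F U K y⁆ = ∑ ij ∈ Finset.range K ×ˢ Finset.range K, f ij := by
    rw [expAd_apply, expAd_apply, Finset.sum_product, sum_lie]
    exact Finset.sum_congr rfl fun a _ => lie_sum ..
  have h2 : expAd F U K ⁅x, y⁆ =
      ∑ ij ∈ (Finset.range K ×ˢ Finset.range K).filter (fun ij => ij.1 + ij.2 < K), f ij := by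
    rw [expAd_apply, ← Finset.sum_fiberwise_of_maps_to (t := Finset.range K)
      (g := fun ij : ℕ × ℕ => ij.1 + ij.2)
      (fun ij hij => Finset.mem_range.2 (Finset.mem_filter.1 hij).2)]
    refine Finset.sum_congr rfl fun k hk => ?_
    rw [inv_factorial_smul_ad_pow_lie]
    refine Finset.sum_congr ?_ fun _ _ => rfl
    ext ⟨a, b⟩
    have := Finset.mem_range.1 hk
    simp only [Finset.HasAntidiagonal.mem_antidiagonal, Finset.mem_filter, Finset.mem_product,
      Finset.mem_range]
    omega
  rw [h1, h2, ← Finset.sum_filter_add_sum_filter_not (Finset.range K ×ˢ Finset.range K)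
    (fun ij => ij.1 + ij.2 < K), add_sub_cancel_left]
  refine Submodule.sum_mem _ fun ij hij => ?_
  have h3 := (Finset.mem_filter.1 hij).2
  refine hfil.anti ?_ (hfil.lie_mem (hfil.ad_pow_mem hU hx ij.1) (hfil.ad_pow_mem hU hy ij.2))
  push Not at h3
  have : (K : ℤ) ≤ ij.1 + ij.2 := by exact_mod_cast h3
  linarith

end IsLieFiltration

end TruncatedExp

/-! ### The grading of `𝔤` -/

section Grading

variable {F 𝔤 : Type*} [Field F] [LieRing 𝔤] [LieAlgebra F 𝔤]

theorem mem_grade_iff {h a : 𝔤} {k : ℤ} :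
    a ∈ grade (F := F) h k ↔ (2 : F)⁻¹ • ⁅h, a⁆ = ((k : F) / 2) • a := by
  rw [grade, Module.End.mem_eigenspace_iff, LieAlgebra.ad_apply, smul_lie]

theorem lie_mem_grade {h a b : 𝔤} {i j : ℤ} (ha : a ∈ grade (F := F) h i)
    (hb : b ∈ grade (F := F) h j) : ⁅a, b⁆ ∈ grade (F := F) h (i + j) := by
  rw [mem_grade_iff] at *
  rw [leibniz_lie, smul_add, ← smul_lie, ha, ← lie_smul, hb, smul_lie, lie_smul, ← add_smul]
  push_cast
  ring_nf

theorem form_eq_zero_of_grade [CharZero F] (κ : LinearMap.BilinForm F 𝔤)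
    (hinv : ∀ a b c, κ ⁅a, b⁆ c = κ a ⁅b, c⁆) {h a b : 𝔤} {i j : ℤ} (hij : i + j ≠ 0)
    (ha : a ∈ grade (F := F) h i) (hb : b ∈ grade (F := F) h j) : κ a b = 0 := by
  rw [mem_grade_iff] at *
  have h1 : κ ((2 : F)⁻¹ • ⁅h, a⁆) b = - κ a ((2 : F)⁻¹ • ⁅h, b⁆) := by
    rw [map_smul, LinearMap.smul_apply, map_smul, ← hinv, ← lie_skew, map_neg, LinearMap.neg_apply,
      smul_neg]
  rw [ha, hb, map_smul, LinearMap.smul_apply, map_smul, smul_eq_mul, smul_eq_mul] at h1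
  have h2 : ((i + j : ℤ) : F) * κ a b = 0 := by push_cast; linear_combination 2 * h1
  exact (mul_eq_zero.1 h2).resolve_left (by exact_mod_cast hij)

theorem iSupIndep_grade [CharZero F] (h : 𝔤) : iSupIndep fun k => grade (F := F) h k := by
  have hinj : Function.Injective fun k : ℤ => (k : F) / 2 := fun a b hab => by
    have h2 : (2 : F) ≠ 0 := two_ne_zero
    exact Int.cast_injective ((div_left_inj' h2).1 hab)
  exact (Module.End.eigenspaces_iSupIndep (LieAlgebra.ad F 𝔤 ((2 : F)⁻¹ • h))).comp hinj

/-- A basis of `𝔤` consisting of `ad x`-eigenvectors. -/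
structure HomBasis (F : Type*) {𝔤 : Type*} [Field F] [LieRing 𝔤] [LieAlgebra F 𝔤] (h : 𝔤) where
  /-- The index set. -/
  I : Type
  /-- The index set is finite. -/
  fintype : Fintype I
  /-- The basis. -/
  c : Module.Basis I F 𝔤
  /-- Twice the degree of a basis element. -/
  deg : I → ℤ
  repr_eq_zero : ∀ {k : ℤ} {a : 𝔤} (i : I), a ∈ grade (F := F) h k → deg i ≠ k → c.repr a i = 0
  mem_grade : ∀ i, c i ∈ grade (F := F) h (deg i)

attribute [instance] HomBasis.fintype

theorem exists_homBasis [CharZero F] [FiniteDimensional F 𝔤] {h : 𝔤}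
    (htop : ⨆ k, grade (F := F) h k = ⊤) : Nonempty (HomBasis F h) := by
  classical
  have hint : DirectSum.IsInternal fun k => grade (F := F) h k :=
    DirectSum.isInternal_submodule_of_iSupIndep_of_iSup_eq_top (iSupIndep_grade h) htop
  let v : ∀ k : ℤ, Module.Basis (Fin (Module.finrank F (grade (F := F) h k))) F
    (grade (F := F) h k) := fun k => Module.finBasis F _
  let c := hint.collectedBasis v
  have : Finite (Σ k : ℤ, Fin (Module.finrank F (grade (F := F) h k))) := Module.Finite.finite_basis c
  exact ⟨⟨_, Fintype.ofFinite _, c, fun i => i.1,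
    fun i ha hne => hint.collectedBasis_repr_of_mem_ne v (Ne.symm hne) ha,
    fun i => hint.collectedBasis_mem v i⟩⟩

theorem HomBasis.repr_eq_zero_of_gradeGT {h : 𝔤} (B : HomBasis F h) {k : ℤ} {a : 𝔤}
    (ha : a ∈ gradeGT (F := F) h k) (i : B.I) (hi : B.deg i ≤ k) : B.c.repr a i = 0 := by
  have : gradeGT (F := F) h k ≤ LinearMap.ker (B.c.coord i) :=
    iSup_le fun j x hx => B.repr_eq_zero i hx (by have := j.2; omega)
  exact this ha

end Grading

/-! ### The degree filtration of `(𝔤 ⊗ A)((z⁻¹))` -/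

section Filtration

variable {F 𝔤 A : Type*} [Field F] [LieRing 𝔤] [LieAlgebra F 𝔤] [CommRing A] [Algebra F A]

variable (A) in
/-- The elements of `(𝔤 ⊗ A)((z⁻¹))` of degree at least `k/2`, where `z` has degree `-D/2`. -/
def fil (h : 𝔤) (D k : ℤ) : Submodule F (Laur A ⊗[F] 𝔤) :=
  Submodule.span F {x | ∃ (j : ℤ) (u : Laur A) (a : 𝔤),
    u ∈ ordGE F A D (k - j) ∧ a ∈ grade (F := F) h j ∧ x = u ⊗ₜ a}

theorem tmul_mem_fil {h : 𝔤} {D k j : ℤ} {u : Laur A} {a : 𝔤} (hu : u ∈ ordGE F A D (k - j))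
    (ha : a ∈ grade (F := F) h j) : u ⊗ₜ a ∈ fil (F := F) A h D k :=
  Submodule.subset_span ⟨j, u, a, hu, ha, rfl⟩

theorem isLieFiltration_fil (h : 𝔤) (D : ℤ) : IsLieFiltration (fil (F := F) A h D) where
  anti i j hij := Submodule.span_mono <| by
    rintro _ ⟨k, u, a, hu, ha, rfl⟩
    exact ⟨k, u, a, ordGE_anti D (by linarith) hu, ha, rfl⟩
  lie_mem {i j x y} hx hy := by
    refine Submodule.span_induction (p := fun x _ => ⁅x, y⁆ ∈ fil (F := F) A h D (i + j))
      ?_ (by simp) (fun x x' _ _ hx hx' => by rw [add_lie]; exact add_mem hx hx')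
      (fun t x _ hx => by rw [smul_lie]; exact Submodule.smul_mem _ t hx) hx
    rintro _ ⟨m, u, a, hu, ha, rfl⟩
    refine Submodule.span_induction (p := fun y _ => ⁅u ⊗ₜ[F] a, y⁆ ∈ fil (F := F) A h D (i + j))
      ?_ (by simp) (fun x x' _ _ hx hx' => by rw [lie_add]; exact add_mem hx hx')
      (fun t x _ hx => by rw [lie_smul]; exact Submodule.smul_mem _ t hx) hy
    rintro _ ⟨n, v, b, hv, hb, rfl⟩
    rw [LieAlgebra.ExtendScalars.bracket_tmul]
    refine tmul_mem_fil ?_ (lie_mem_grade ha hb)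
    have := mul_mem_ordGE hu hv
    rwa [show i - m + (j - n) = i + j - (m + n) by ring] at this

theorem rTensor_mapL_mem_fil (φ : A →ₗ[F] A) {h : 𝔤} {D k : ℤ} {x : Laur A ⊗[F] 𝔤}
    (hx : x ∈ fil (F := F) A h D k) :
    LinearMap.rTensor 𝔤 (mapL φ) x ∈ fil (F := F) A h D k := by
  refine Submodule.span_le (p := (fil (F := F) A h D k).comap (LinearMap.rTensor 𝔤 (mapL φ))).2 ?_ hx
  rintro _ ⟨j, u, a, hu, ha, rfl⟩
  exact tmul_mem_fil (mapL_mem_ordGE φ hu) ha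

theorem exists_mem_fil {h : 𝔤} (htop : ⨆ k, grade (F := F) h k = ⊤) {D : ℤ} (hD : 0 < D)
    (x : Laur A ⊗[F] 𝔤) : ∃ k, x ∈ fil (F := F) A h D k := by
  induction x using TensorProduct.induction_on with
  | zero => exact ⟨0, zero_mem _⟩
  | add x y hx hy =>
    obtain ⟨k, hk⟩ := hx
    obtain ⟨m, hm⟩ := hy
    exact ⟨min k m, add_mem ((isLieFiltration_fil h D).anti (min_le_left k m) hk)
      ((isLieFiltration_fil h D).anti (min_le_right k m) hm)⟩
  | tmul u a =>
    obtain ⟨N, hN⟩ := exists_mem_ordGE (F := F) hD u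
    have ha : a ∈ ⨆ k, grade (F := F) h k := htop ▸ Submodule.mem_top
    induction ha using Submodule.iSup_induction' with
    | mem j a ha => exact ⟨N + j, tmul_mem_fil (by simpa using hN) ha⟩
    | zero => exact ⟨0, by simp⟩
    | add a b _ _ ha hb =>
      obtain ⟨k, hk⟩ := ha
      obtain ⟨m, hm⟩ := hb
      refine ⟨min k m, ?_⟩
      rw [TensorProduct.tmul_add]
      exact add_mem ((isLieFiltration_fil h D).anti (min_le_left k m) hk)
        ((isLieFiltration_fil h D).anti (min_le_right k m) hm)

variable {h : 𝔤} (B : HomBasis F h)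

namespace HomBasis

variable (A) in
/-- The `i`-th coordinate of an element of `(𝔤 ⊗ A)((z⁻¹))` in the homogeneous basis. -/
def coordL (i : B.I) : Laur A ⊗[F] 𝔤 →ₗ[F] Laur A :=
  (TensorProduct.rid F (Laur A)).toLinearMap ∘ₗ LinearMap.lTensor (Laur A) (B.c.coord i)

theorem coordL_tmul (i : B.I) (u : Laur A) (a : 𝔤) :
    B.coordL A i (u ⊗ₜ a) = B.c.repr a i • u := by
  simp [coordL]

theorem sum_coordL_tmul (x : Laur A ⊗[F] 𝔤) : ∑ i, B.coordL A i x ⊗ₜ[F] B.c i = x := by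
  induction x using TensorProduct.induction_on with
  | zero => simp
  | add x y hx hy =>
    simp only [map_add, TensorProduct.add_tmul, Finset.sum_add_distrib, hx, hy]
  | tmul u a =>
    simp only [coordL_tmul, TensorProduct.smul_tmul]
    rw [← TensorProduct.tmul_sum, B.c.sum_repr]

theorem mem_fil_iff {D k : ℤ} {x : Laur A ⊗[F] 𝔤} :
    x ∈ fil (F := F) A h D k ↔ ∀ i, B.coordL A i x ∈ ordGE F A D (k - B.deg i) := by
  constructor
  · intro hx i
    refine Submodule.span_le (p := (ordGE F A D (k - B.deg i)).comap (B.coordL A i)).2 ?_ hx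
    rintro _ ⟨j, u, a, hu, ha, rfl⟩
    change B.coordL A i (u ⊗ₜ a) ∈ ordGE F A D (k - B.deg i)
    rw [coordL_tmul]
    by_cases hj : B.deg i = j
    · rw [hj]; exact Submodule.smul_mem _ _ hu
    · rw [B.repr_eq_zero i ha hj, zero_smul]; exact zero_mem _
  · intro hx
    rw [← B.sum_coordL_tmul x]
    exact Submodule.sum_mem _ fun i _ => tmul_mem_fil (hx i) (B.mem_grade i)

theorem coordL_rTensor {A' : Type*} [CommRing A'] [Algebra F A'] (φ : A →ₗ[F] A') (i : B.I)
    (x : Laur A ⊗[F] 𝔤) :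
    B.coordL A' i (LinearMap.rTensor 𝔤 (mapL φ) x) = mapL φ (B.coordL A i x) := by
  induction x using TensorProduct.induction_on with
  | zero => simp
  | add x y hx hy => simp only [map_add, hx, hy]
  | tmul u a => rw [LinearMap.rTensor_tmul, coordL_tmul, coordL_tmul, map_smul]

theorem repr_coeffG (n : ℤ) (x : Laur F ⊗[F] 𝔤) (i : B.I) :
    B.c.repr (coeffG F 𝔤 n x) i = coeffL F F n (B.coordL F i x) := by
  induction x using TensorProduct.induction_on with
  | zero => simp
  | add x y hx hy => simp only [map_add, Finsupp.add_apply, hx, hy]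
  | tmul u a =>
    rw [coordL_tmul, map_smul]
    simp [coeffG, coeffZ, mul_comm]

theorem coeffL_coordL_eq_zero {n : ℤ} {x : Laur A ⊗[F] 𝔤} (hx : coeffZ F 𝔤 A n x = 0) (i : B.I) :
    coeffL F A n (B.coordL A i x) = 0 := by
  have : coeffL F A n (B.coordL A i x) = (TensorProduct.rid F A)
      (LinearMap.lTensor A (B.c.coord i) (coeffZ F 𝔤 A n x)) := by
    clear hx
    induction x using TensorProduct.induction_on with
    | zero => simp
    | add x y hx hy => simp only [map_add, hx, hy]
    | tmul u a => rw [coordL_tmul, map_smul]; simp [coeffZ]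
  rw [this, hx, map_zero, map_zero]

/-- Elements of `(𝔤 ⊗ A)((z⁻¹))` are separated by contractions with linear forms on `A`. -/
theorem eq_zero_of_contractions (B : HomBasis F h) {x : Laur A ⊗[F] 𝔤}
    (hx : ∀ φ : Module.Dual F A, LinearMap.rTensor 𝔤 (mapL φ) x = 0) : x = 0 := by
  rw [← B.sum_coordL_tmul x]
  refine Finset.sum_eq_zero fun i _ => ?_
  have : B.coordL A i x = 0 := laur_ext F fun n => by
    rw [map_zero]
    refine (Module.forall_dual_apply_eq_zero_iff F _).1 fun φ => ?_
    rw [← coeffL_mapL, ← coordL_rTensor, hx φ, map_zero, map_zero]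
  rw [this, TensorProduct.zero_tmul]

/-- Membership in the completed tensor product, defined by contractions, gives membership in the
degree filtration; `> k/2` is `≥ (k + 1)/2`. -/
theorem extendSub_gzGT_le (B : HomBasis F h) (d k : ℤ) :
    extendSub A (gzGT (F := F) h d k) ≤ fil A h (d + 2) (k + 1) := by
  intro x hx
  rw [B.mem_fil_iff]
  intro i n hn
  refine (Module.forall_dual_apply_eq_zero_iff F _).1 fun φ => ?_
  have h1 := (Submodule.mem_iInf _).1 ((Submodule.mem_iInf _).1 hx φ) n
  rw [← coeffL_mapL, ← coordL_rTensor, ← repr_coeffG]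
  exact B.repr_eq_zero_of_gradeGT h1 i (by linarith)

end HomBasis

end Filtration

/-! ### The invariant form on `(𝔤 ⊗ 𝒱)((z⁻¹))` -/

section Form

variable {F 𝔤 ι : Type*} [Field F] [LieRing 𝔤] [LieAlgebra F 𝔤] (κ : LinearMap.BilinForm F 𝔤)

theorem kappaZ_tmul (u v : Laur (DiffPoly F ι)) (a b : 𝔤) :
    kappaZ κ (u ⊗ₜ a) (v ⊗ₜ b) = κ a b • (u * v) := rfl

theorem kappaZ_add_left (x x' y : GV F 𝔤 ι) :
    kappaZ κ (x + x') y = kappaZ κ x y + kappaZ κ x' y := by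
  rw [kappaZ, map_add]; rfl

theorem kappaZ_add_right (x y y' : GV F 𝔤 ι) :
    kappaZ κ x (y + y') = kappaZ κ x y + kappaZ κ x y' := map_add _ _ _

theorem kappaZ_sub_right (x y y' : GV F 𝔤 ι) :
    kappaZ κ x (y - y') = kappaZ κ x y - kappaZ κ x y' := map_sub _ _ _

theorem kappaZ_neg_right (x y : GV F 𝔤 ι) : kappaZ κ x (-y) = -kappaZ κ x y := map_neg _ _

theorem kappaZ_zero_left (y : GV F 𝔤 ι) : kappaZ κ 0 y = 0 := by
  rw [kappaZ, map_zero]; rfl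

theorem kappaZ_zero_right (x : GV F 𝔤 ι) : kappaZ κ x 0 = 0 := map_zero _

theorem kappaZ_mul_left (w : Laur (DiffPoly F ι)) (x y : GV F 𝔤 ι) :
    kappaZ κ (w • x) y = w * kappaZ κ x y := by
  rw [kappaZ, map_smul]; rfl

theorem kappaZ_mul_right (w : Laur (DiffPoly F ι)) (x y : GV F 𝔤 ι) :
    kappaZ κ x (w • y) = w * kappaZ κ x y := map_smul _ _ _

theorem kappaZ_smul_left (c : F) (x y : GV F 𝔤 ι) :
    kappaZ κ (c • x) y = c • kappaZ κ x y := by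
  rw [kappaZ, LinearMap.map_smul_of_tower]; rfl

theorem kappaZ_smul_right (c : F) (x y : GV F 𝔤 ι) :
    kappaZ κ x (c • y) = c • kappaZ κ x y := LinearMap.map_smul_of_tower _ _ _

theorem kappaZ_sum_right {α : Type*} (s : Finset α) (x : GV F 𝔤 ι) (y : α → GV F 𝔤 ι) :
    kappaZ κ x (∑ i ∈ s, y i) = ∑ i ∈ s, kappaZ κ x (y i) := map_sum _ _ _

variable {κ}

theorem kappaZ_symm (hκ : ∀ a b, κ a b = κ b a) (x y : GV F 𝔤 ι) :
    kappaZ κ x y = kappaZ κ y x := by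
  induction x using TensorProduct.induction_on with
  | zero => rw [kappaZ_zero_left, kappaZ_zero_right]
  | add x x' hx hx' => rw [kappaZ_add_left, kappaZ_add_right, hx, hx']
  | tmul u a =>
    induction y using TensorProduct.induction_on with
    | zero => rw [kappaZ_zero_left, kappaZ_zero_right]
    | add x x' hx hx' => rw [kappaZ_add_left, kappaZ_add_right, hx, hx']
    | tmul v b => rw [kappaZ_tmul, kappaZ_tmul, hκ, mul_comm]

theorem kappaZ_lie (hinv : ∀ a b c, κ ⁅a, b⁆ c = κ a ⁅b, c⁆) (x y w : GV F 𝔤 ι) :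
    kappaZ κ ⁅x, y⁆ w = kappaZ κ x ⁅y, w⁆ := by
  induction x using TensorProduct.induction_on with
  | zero => simp only [zero_lie, kappaZ_zero_left]
  | add x x' hx hx' => simp only [add_lie, kappaZ_add_left, hx, hx']
  | tmul u a =>
    induction y using TensorProduct.induction_on with
    | zero => simp only [zero_lie, lie_zero, kappaZ_zero_left, kappaZ_zero_right]
    | add x x' hx hx' => simp only [lie_add, add_lie, kappaZ_add_left, kappaZ_add_right, hx, hx']
    | tmul v b =>
      induction w using TensorProduct.induction_on with
      | zero => simp only [lie_zero, kappaZ_zero_right]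
      | add x x' hx hx' => simp only [lie_add, kappaZ_add_right, hx, hx']
      | tmul t c =>
        rw [LieAlgebra.ExtendScalars.bracket_tmul, LieAlgebra.ExtendScalars.bracket_tmul,
          kappaZ_tmul, kappaZ_tmul, hinv, mul_assoc]

theorem coeffDer_apply {A : Type*} [CommRing A] [Algebra F A] (δ : Derivation F A A)
    (x : Laur A ⊗[F] 𝔤) : coeffDer δ x = LinearMap.rTensor 𝔤 (mapL δ.toLinearMap) x := rfl

theorem coeffDer_tmul {A : Type*} [CommRing A] [Algebra F A] (δ : Derivation F A A)
    (u : Laur A) (a : 𝔤) : coeffDer δ (u ⊗ₜ[F] a) = mapL δ.toLinearMap u ⊗ₜ a := rfl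

theorem mapL_kappaZ (δ : Derivation F (DiffPoly F ι) (DiffPoly F ι)) (x y : GV F 𝔤 ι) :
    mapL δ.toLinearMap (kappaZ κ x y) = kappaZ κ (coeffDer δ x) y + kappaZ κ x (coeffDer δ y) := by
  induction x using TensorProduct.induction_on with
  | zero => simp only [map_zero, kappaZ_zero_left, add_zero]
  | add x x' hx hx' => simp only [map_add, kappaZ_add_left, hx, hx']; abel
  | tmul u a =>
    induction y using TensorProduct.induction_on with
    | zero => simp only [map_zero, kappaZ_zero_right, add_zero]
    | add x x' hx hx' => simp only [map_add, kappaZ_add_right, hx, hx']; abel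
    | tmul v b =>
      rw [coeffDer_tmul, coeffDer_tmul, kappaZ_tmul, kappaZ_tmul, kappaZ_tmul, map_smul,
        mapL_derivation_mul, smul_add, add_comm]

theorem kappaZ_mem_ordGE [CharZero F] (hinv : ∀ a b c, κ ⁅a, b⁆ c = κ a ⁅b, c⁆) {h : 𝔤}
    {D i j : ℤ} {x y : GV F 𝔤 ι} (hx : x ∈ fil (F := F) (DiffPoly F ι) h D i)
    (hy : y ∈ fil (F := F) (DiffPoly F ι) h D j) :
    kappaZ κ x y ∈ ordGE F (DiffPoly F ι) D (i + j) := by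
  refine Submodule.span_induction
    (p := fun x _ => kappaZ κ x y ∈ ordGE F (DiffPoly F ι) D (i + j))
    ?_ (by rw [kappaZ_zero_left]; exact zero_mem _)
    (fun x x' _ _ hx hx' => by rw [kappaZ_add_left]; exact add_mem hx hx')
    (fun t x _ hx => by rw [kappaZ_smul_left]; exact Submodule.smul_mem _ t hx) hx
  rintro _ ⟨m, u, a, hu, ha, rfl⟩
  refine Submodule.span_induction
    (p := fun y _ => kappaZ κ (u ⊗ₜ[F] a) y ∈ ordGE F (DiffPoly F ι) D (i + j))
    ?_ (by rw [kappaZ_zero_right]; exact zero_mem _)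
    (fun x x' _ _ hx hx' => by rw [kappaZ_add_right]; exact add_mem hx hx')
    (fun t x _ hx => by rw [kappaZ_smul_right]; exact Submodule.smul_mem _ t hx) hy
  rintro _ ⟨n, v, b, hv, hb, rfl⟩
  rw [kappaZ_tmul]
  by_cases hmn : m + n = 0
  · have := mul_mem_ordGE hu hv
    rw [show i - m + (j - n) = i + j by linarith] at this
    exact Submodule.smul_mem _ _ this
  · rw [form_eq_zero_of_grade κ hinv hmn ha hb, zero_smul]
    exact zero_mem _

end Form

section TensorOne

variable {F 𝔤 A : Type*} [Field F] [LieRing 𝔤] [LieAlgebra F 𝔤] [CommRing A] [Algebra F A]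

theorem tensorOne_tmul (u : Laur F) (a : 𝔤) :
    tensorOne (A := A) (u ⊗ₜ[F] a) = mapL (Algebra.linearMap F A) u ⊗ₜ a := rfl

/-- Contraction with a linear form commutes with the bracket with a series with constant
coefficients. -/
theorem rTensor_tensorOne_lie {B : Type*} [CommRing B] [Algebra F B] (φ : A →ₗ[F] B)
    (x : Laur F ⊗[F] 𝔤) (y : Laur A ⊗[F] 𝔤) :
    LinearMap.rTensor 𝔤 (mapL φ) ⁅tensorOne (A := A) x, y⁆ =
      ⁅tensorOne (A := B) x, LinearMap.rTensor 𝔤 (mapL φ) y⁆ := by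
  induction x using TensorProduct.induction_on with
  | zero => simp
  | add x x' hx hx' => simp only [map_add, add_lie, hx, hx']
  | tmul u a =>
    induction y using TensorProduct.induction_on with
    | zero => simp
    | add x x' hx hx' => simp only [map_add, lie_add, hx, hx']
    | tmul v b =>
      rw [tensorOne_tmul, tensorOne_tmul, LieAlgebra.ExtendScalars.bracket_tmul,
        LinearMap.rTensor_tmul, LinearMap.rTensor_tmul, LieAlgebra.ExtendScalars.bracket_tmul,
        mapL_const_mul]

theorem tensorOne_self (x : Laur F ⊗[F] 𝔤) : tensorOne (A := F) x = x := by
  have : mapL (Algebra.linearMap F F) = LinearMap.id := rfl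
  rw [tensorOne, this, LinearMap.rTensor_id]; rfl

theorem tensorOne_lie (x y : Laur F ⊗[F] 𝔤) :
    tensorOne (A := A) ⁅x, y⁆ = ⁅tensorOne (A := A) x, tensorOne (A := A) y⁆ := by
  have := rTensor_tensorOne_lie (A := F) (Algebra.linearMap F A) x y
  rwa [tensorOne_self] at this

theorem coeffDer_tensorOne (δ : Derivation F A A) (x : Laur F ⊗[F] 𝔤) :
    coeffDer δ (tensorOne (A := A) x) = 0 := by
  have : mapL δ.toLinearMap ∘ₗ mapL (Algebra.linearMap F A) = 0 := by
    refine LinearMap.ext fun u => laur_ext F fun n => ?_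
    rw [LinearMap.comp_apply, coeffL_mapL, coeffL_mapL, LinearMap.zero_apply, map_zero]
    exact δ.map_algebraMap _
  rw [coeffDer_apply, tensorOne, ← LinearMap.comp_apply, ← LinearMap.rTensor_comp, this]
  simp

end TensorOne

/-! ### Derivations acting on `(𝔤 ⊗ 𝒱)((z⁻¹))` -/

section DerGV

variable {F 𝔤 ι : Type*} [Field F] [LieRing 𝔤] [LieAlgebra F 𝔤]

theorem lieHom_expAd {L L' : Type*} [LieRing L] [LieAlgebra F L] [LieRing L']
    [LieAlgebra F L'] (φ : L →ₗ⁅F⁆ L') (U x : L) (K : ℕ) :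
    φ (expAd F U K x) = expAd F (φ U) K (φ x) := by
  rw [expAd_apply, expAd_apply, map_sum]
  refine Finset.sum_congr rfl fun k hk => ?_
  clear hk
  rw [map_smul]
  congr 1
  induction k with
  | zero => rfl
  | succ k ih =>
    rw [pow_succ', pow_succ', Module.End.mul_apply, Module.End.mul_apply, LieAlgebra.ad_apply,
      LieHom.map_lie, ih, LieAlgebra.ad_apply]

variable (F 𝔤 ι) in
/-- The semidirect product of `(𝔤 ⊗ 𝒱)((z⁻¹))` with all of its derivations; it contains
`F∂ ⋉ (𝔤 ⊗ 𝒱)((z⁻¹))` and the evolutionary vector fields. -/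
abbrev DerGV : Type _ :=
  LieAlgebra.SemiDirectSum (GV F 𝔤 ι) (LieDerivation F (GV F 𝔤 ι) (GV F 𝔤 ι))
    (LieHom.id : LieDerivation F (GV F 𝔤 ι) (GV F 𝔤 ι) →ₗ⁅F⁆ _)

variable (F 𝔤 ι) in
/-- The homomorphism from `F∂ ⋉ (𝔤 ⊗ 𝒱)((z⁻¹))` given by the action of `∂`. -/
def toDerGV : DelGV F 𝔤 ι →ₗ⁅F⁆ DerGV F 𝔤 ι where
  toFun x := ⟨x.left, delAction x.right⟩
  map_add' x y := by simp
  map_smul' c x := by simp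
  map_lie' {x y} := by simp

theorem toDerGV_apply (x : DelGV F 𝔤 ι) : toDerGV F 𝔤 ι x = ⟨x.left, delAction x.right⟩ := rfl

theorem delAction_one : delAction (F := F) (𝔤 := 𝔤) (ι := ι) FDel.one = coeffDer del :=
  one_smul F _

variable (F 𝔤 ι) in
/-- The embedding of `(𝔤 ⊗ 𝒱)((z⁻¹))` into its semidirect product with the derivations. -/
abbrev inlGV : GV F 𝔤 ι →ₗ⁅F⁆ DerGV F 𝔤 ι := LieAlgebra.SemiDirectSum.inl _

variable (F ι) in
/-- The extension of the degree filtration to derivations: those that preserve the filtration have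
degree at least `0`. -/
def filDer (h : 𝔤) (D k : ℤ) : Submodule F (DerGV F 𝔤 ι) where
  carrier := {x | x.left ∈ fil (F := F) (DiffPoly F ι) h D k ∧ (0 < k → x.right = 0) ∧
    ∀ j y, y ∈ fil (F := F) (DiffPoly F ι) h D j →
      x.right y ∈ fil (F := F) (DiffPoly F ι) h D j}
  add_mem' {x y} hx hy := ⟨add_mem hx.1 hy.1,
    fun hk => show x.right + y.right = 0 by rw [hx.2.1 hk, hy.2.1 hk, add_zero],
    fun j w hw => add_mem (hx.2.2 j w hw) (hy.2.2 j w hw)⟩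
  zero_mem' := ⟨zero_mem _, fun _ => rfl, fun _ _ _ => zero_mem _⟩
  smul_mem' c x hx := ⟨Submodule.smul_mem _ c hx.1,
    fun hk => show c • x.right = 0 by rw [hx.2.1 hk, smul_zero],
    fun j w hw => Submodule.smul_mem _ c (hx.2.2 j w hw)⟩

theorem isLieFiltration_filDer (h : 𝔤) (D : ℤ) : IsLieFiltration (filDer F ι h D) where
  anti i j hij x hx := ⟨(isLieFiltration_fil h D).anti hij hx.1,
    fun hi => hx.2.1 (hi.trans_le hij), hx.2.2⟩
  lie_mem {i j x y} hx hy := by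
    have key : ∀ {i j : ℤ} {x y : DerGV F 𝔤 ι}, x ∈ filDer F ι h D i → y ∈ filDer F ι h D j →
        x.right y.left ∈ fil (F := F) (DiffPoly F ι) h D (i + j) := by
      intro i j x y hx hy
      rcases lt_or_ge 0 i with hi | hi
      · rw [hx.2.1 hi]; exact zero_mem _
      · exact (isLieFiltration_fil h D).anti (by linarith) (hx.2.2 j _ hy.1)
    refine ⟨?_, fun hij => ?_, fun m w hw => ?_⟩
    · refine sub_mem (add_mem ((isLieFiltration_fil h D).lie_mem hx.1 hy.1) (key hx hy)) ?_
      rw [add_comm i j]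
      exact key hy hx
    · change ⁅x.right, y.right⁆ = 0
      rcases lt_or_ge 0 i with hi | hi
      · rw [hx.2.1 hi, zero_lie]
      · rw [hy.2.1 (by linarith), lie_zero]
    · change ⁅x.right, y.right⁆ w ∈ _
      rw [LieDerivation.lie_apply]
      exact sub_mem (hx.2.2 _ _ (hy.2.2 _ _ hw)) (hy.2.2 _ _ (hx.2.2 _ _ hw))

theorem inlGV_mem_filDer {h : 𝔤} {D k : ℤ} {x : GV F 𝔤 ι} :
    inlGV F 𝔤 ι x ∈ filDer F ι h D k ↔ x ∈ fil (F := F) (DiffPoly F ι) h D k :=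
  ⟨fun hx => hx.1, fun hx => ⟨hx, fun _ => rfl, fun _ _ _ => zero_mem _⟩⟩

theorem coeffDer_mem_fil (δ : Derivation F (DiffPoly F ι) (DiffPoly F ι)) {h : 𝔤} {D k : ℤ}
    {x : GV F 𝔤 ι} (hx : x ∈ fil (F := F) (DiffPoly F ι) h D k) :
    coeffDer δ x ∈ fil (F := F) (DiffPoly F ι) h D k :=
  rTensor_mapL_mem_fil _ hx

theorem mk_coeffDer_mem_filDer (δ : Derivation F (DiffPoly F ι) (DiffPoly F ι)) {h : 𝔤} {D k : ℤ}
    (hk : k ≤ 0) {x : GV F 𝔤 ι} (hx : x ∈ fil (F := F) (DiffPoly F ι) h D k) :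
    (⟨x, coeffDer δ⟩ : DerGV F 𝔤 ι) ∈ filDer F ι h D k :=
  ⟨hx, fun h0 => absurd h0 (not_lt.2 hk), fun _ _ hy => coeffDer_mem_fil δ hy⟩

/-- The exponential of `ad U`, for `U` in the ideal `(𝔤 ⊗ 𝒱)((z⁻¹))`, does not change the
derivation component. -/
theorem expAd_inlGV_right (U : GV F 𝔤 ι) (x : DerGV F 𝔤 ι) (K : ℕ) :
    (expAd F (inlGV F 𝔤 ι U) (K + 1) x).right = x.right := by
  have h1 := lieHom_expAd (LieAlgebra.SemiDirectSum.projr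
    (LieHom.id : LieDerivation F (GV F 𝔤 ι) (GV F 𝔤 ι) →ₗ⁅F⁆ _)) (inlGV F 𝔤 ι U) x (K + 1)
  rw [LieAlgebra.SemiDirectSum.projr_inl_apply] at h1
  change (expAd F (inlGV F 𝔤 ι U) (K + 1) x).right = expAd F 0 (K + 1) x.right at h1
  rw [h1, expAd_apply, Finset.sum_range_succ']
  simp

end DerGV

/-! ### Evolutionary vector fields -/

section Evolutionary

variable {F ι : Type*} [Field F]

theorem mkDerivation_eq_sum {σ N : Type*} [AddCommGroup N] [Module F N]
    [Module (MvPolynomial σ F) N] [IsScalarTower F (MvPolynomial σ F) N] (y : σ → N)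
    (g : MvPolynomial σ F) (s : Finset σ) (hs : g.vars ⊆ s) :
    MvPolynomial.mkDerivation F y g = ∑ v ∈ s, MvPolynomial.pderiv v g • y v := by
  classical
  let E : σ → Derivation F (MvPolynomial σ F) N := fun v =>
    (LinearMap.toSpanSingleton (MvPolynomial σ F) N (y v)).compDer (MvPolynomial.pderiv v)
  have hsum : ∀ x, (∑ v ∈ s, E v) x = ∑ v ∈ s, MvPolynomial.pderiv v x • y v := fun x => by
    rw [← Derivation.coeFnAddMonoidHom_apply, map_sum, Finset.sum_apply]; rfl
  rw [← hsum]
  refine MvPolynomial.derivation_eq_of_forall_mem_vars fun i hi => ?_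
  rw [hsum, MvPolynomial.mkDerivation_X, Finset.sum_eq_single i]
  · simp
  · intro v _ hv
    simp [MvPolynomial.pderiv_X_of_ne hv.symm]
  · exact fun h => absurd (hs hi) h

/-- A bound for the order of a differential polynomial. -/
theorem exists_vars_subset [Fintype ι] (g : DiffPoly F ι) :
    ∃ N : ℕ, g.vars ⊆ Finset.univ ×ˢ Finset.range N := by
  classical
  refine ⟨(g.vars.sup Prod.snd) + 1, fun v hv => ?_⟩
  simp only [Finset.mem_product, Finset.mem_univ, Finset.mem_range, true_and]
  exact Nat.lt_succ_of_le (Finset.le_sup (f := Prod.snd) hv)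

theorem pderiv_eq_zero_of_le [Fintype ι] {g : DiffPoly F ι} {N : ℕ}
    (hN : g.vars ⊆ Finset.univ ×ˢ Finset.range N) (i : ι) {n : ℕ} (hn : N ≤ n) :
    MvPolynomial.pderiv (i, n) g = 0 := by
  refine MvPolynomial.pderiv_eq_zero_of_notMem_vars fun h => ?_
  have := hN h
  simp only [Finset.mem_product, Finset.mem_univ, Finset.mem_range, true_and] at this
  omega

/-- A derivation is determined by its values on the variables; the sum over `n` is finite. -/
theorem mkDerivation_eq_sum_finsum [Fintype ι] {N : Type*} [AddCommGroup N] [Module F N]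
    [Module (DiffPoly F ι) N] [IsScalarTower F (DiffPoly F ι) N] (y : ι × ℕ → N)
    (g : DiffPoly F ι) :
    MvPolynomial.mkDerivation F y g =
      ∑ i, ∑ᶠ n : ℕ, MvPolynomial.pderiv (i, n) g • y (i, n) := by
  obtain ⟨K, hK⟩ := exists_vars_subset g
  rw [mkDerivation_eq_sum y g _ hK, Finset.sum_product]
  refine Finset.sum_congr rfl fun i _ => (finsum_eq_sum_of_support_subset _ ?_).symm
  intro n hn
  by_contra h
  refine hn ?_
  simp only [Finset.coe_range, Set.mem_Iio, not_lt] at h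
  simp only [pderiv_eq_zero_of_le hK i h, zero_smul]

theorem del_X (i : ι) (n : ℕ) :
    del (MvPolynomial.X (i, n) : DiffPoly F ι) = MvPolynomial.X (i, n + 1) :=
  MvPolynomial.mkDerivation_X ..

/-- The evolutionary vector field `X_Q` with `X_Q(u_i^{(n)}) = ∂^n Q_i`. -/
def evol (Q : ι → DiffPoly F ι) : Derivation F (DiffPoly F ι) (DiffPoly F ι) :=
  MvPolynomial.mkDerivation F fun v => (del (F := F) (ι := ι))^[v.2] (Q v.1)

theorem evol_X (Q : ι → DiffPoly F ι) (i : ι) (n : ℕ) :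
    evol Q (MvPolynomial.X (i, n)) = (del (F := F) (ι := ι))^[n] (Q i) :=
  MvPolynomial.mkDerivation_X ..

theorem lie_evol_del (Q : ι → DiffPoly F ι) : ⁅evol Q, del (F := F) (ι := ι)⁆ = 0 := by
  refine MvPolynomial.derivation_ext fun v => ?_
  rw [Derivation.commutator_apply, ← Prod.mk.eta (p := v), del_X, evol_X, evol_X,
    Function.iterate_succ_apply', sub_self, Derivation.zero_apply]

theorem evol_del (Q : ι → DiffPoly F ι) (u : DiffPoly F ι) : evol Q (del u) = del (evol Q u) := by
  have := congrArg (fun D => D u) (lie_evol_del Q)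
  rwa [Derivation.commutator_apply, Derivation.zero_apply, sub_eq_zero] at this

/-- Integration by parts. -/
theorem neg_del_pow_mul_sub_mem (n : ℕ) (u v : DiffPoly F ι) :
    ((-(del (F := F) (ι := ι)).toLinearMap) ^ n) u * v - u * (del (F := F) (ι := ι))^[n] v ∈
      LinearMap.range (del (F := F) (ι := ι)).toLinearMap := by
  induction n generalizing u with
  | zero => simp
  | succ n ih =>
    rw [pow_succ, Module.End.mul_apply, Function.iterate_succ_apply']
    have h1 := ih ((-(del (F := F) (ι := ι)).toLinearMap) u)
    have h2 : del (u * (del (F := F) (ι := ι))^[n] v) ∈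
      LinearMap.range (del (F := F) (ι := ι)).toLinearMap := ⟨_, rfl⟩
    have h3 := sub_mem h1 h2
    rw [Derivation.leibniz, smul_eq_mul, smul_eq_mul] at h3
    convert h3 using 1
    simp only [LinearMap.neg_apply, Derivation.coeFn_coe]
    ring

theorem sum_varDer_mul_sub_mem [Fintype ι] (Q : ι → DiffPoly F ι) (g : DiffPoly F ι) :
    ∑ i, varDer i g * Q i - evol Q g ∈ LinearMap.range (del (F := F) (ι := ι)).toLinearMap := by
  obtain ⟨K, hK⟩ := exists_vars_subset g
  have h1 : ∀ i, varDer i g = ∑ n ∈ Finset.range K,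
      ((-(del (F := F) (ι := ι)).toLinearMap) ^ n) (MvPolynomial.pderiv (i, n) g) := fun i => by
    refine finsum_eq_sum_of_support_subset _ fun n hn => ?_
    by_contra h
    refine hn ?_
    simp only [Finset.coe_range, Set.mem_Iio, not_lt] at h
    simp only [pderiv_eq_zero_of_le hK i h, map_zero]
  rw [evol, mkDerivation_eq_sum _ g _ hK, Finset.sum_product, ← Finset.sum_sub_distrib]
  refine Submodule.sum_mem _ fun i _ => ?_
  rw [h1, Finset.sum_mul, ← Finset.sum_sub_distrib]
  exact Submodule.sum_mem _ fun n _ => neg_del_pow_mul_sub_mem n _ _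

/-- The defining property of the variational derivative, for Laurent series. -/
theorem sum_varDer_mul_mono_sub_mem [Fintype ι] (Q : ι → DiffPoly F ι)
    (g : Laur (DiffPoly F ι)) :
    ∑ i, mapL (varDer i) g * mono 0 (Q i) - mapL (evol Q).toLinearMap g ∈ totalDer F ι := by
  intro n
  rw [map_sub, map_sum]
  simp only [mul_comm _ (mono 0 _), coeffL_mono_mul, sub_zero, coeffL_mapL]
  simp only [mul_comm (Q _)]
  exact sum_varDer_mul_sub_mem Q _

end Evolutionary

/-! ### The gauge action of `𝔫` -/

section Lambda

variable {F ι ι' : Type*} [Field F]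

theorem lamDel_monomial (n : ℕ) (c : DiffPoly F ι) :
    lamDel (Polynomial.monomial n c) =
      Polynomial.monomial (n + 1) c + Polynomial.monomial n (del c) := by
  rw [lamDel, LinearMap.add_apply, LinearMap.mulLeft_apply, Polynomial.X_mul_monomial,
    Polynomial.lsum_apply, Polynomial.sum_monomial_index _ _ (by simp)]
  rfl

theorem lamDel_pow_C_C (k : ℕ) (c : F) :
    ((lamDel (F := F) (ι := ι)) ^ k) (Polynomial.C (MvPolynomial.C c)) =
      Polynomial.monomial k (MvPolynomial.C c) := by
  induction k with
  | zero => rfl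
  | succ k ih =>
    rw [pow_succ', Module.End.mul_apply, ih, lamDel_monomial, MvPolynomial.derivation_C, map_zero,
      add_zero]

theorem applyShift_C_C (A : Polynomial (DiffPoly F ι)) (c : F) :
    applyShift A (Polynomial.C (MvPolynomial.C c)) = A * Polynomial.C (MvPolynomial.C c) := by
  rw [applyShift]
  conv_rhs => rw [← A.sum_monomial_eq, Polynomial.sum, Finset.sum_mul]
  refine Finset.sum_congr rfl fun k _ => ?_
  change Polynomial.C (A.coeff k) * (lamDel ^ k) (Polynomial.C (MvPolynomial.C c)) = _
  rw [lamDel_pow_C_C, Polynomial.C_mul_monomial, Polynomial.monomial_mul_C]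

theorem applyShift_zero (A : Polynomial (DiffPoly F ι)) : applyShift A 0 = 0 := by
  simp [applyShift, Polynomial.sum]

variable (w : DiffPoly F ι')

/-- The evaluation of a polynomial `∑ c_k λ^k` at a differential polynomial `w`: the element
`∑ c_k ∂^k w`. -/
def evalLam : Polynomial (DiffPoly F ι') →ₗ[DiffPoly F ι'] DiffPoly F ι' :=
  Polynomial.lsum fun n =>
    LinearMap.toSpanSingleton (DiffPoly F ι') (DiffPoly F ι') ((del (F := F) (ι := ι'))^[n] w)

theorem evalLam_monomial (n : ℕ) (c : DiffPoly F ι') :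
    evalLam w (Polynomial.monomial n c) = c * (del (F := F) (ι := ι'))^[n] w := by
  rw [evalLam, Polynomial.lsum_apply, Polynomial.sum_monomial_index _ _ (by simp)]
  rfl

theorem evalLam_map_lamDel (ρ : DiffPoly F ι →ₐ[F] DiffPoly F ι')
    (hρ : ∀ u, ρ (del u) = del (ρ u)) (y : Polynomial (DiffPoly F ι)) :
    evalLam w ((lamDel y).map (ρ : DiffPoly F ι →+* DiffPoly F ι')) =
      del (evalLam w (y.map (ρ : DiffPoly F ι →+* DiffPoly F ι'))) := by
  induction y using Polynomial.induction_on' with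
  | add p q hp hq => simp only [map_add, Polynomial.map_add, hp, hq]
  | monomial n c =>
    rw [lamDel_monomial, Polynomial.map_add, Polynomial.map_monomial, Polynomial.map_monomial,
      Polynomial.map_monomial, map_add, evalLam_monomial, evalLam_monomial, evalLam_monomial,
      Derivation.leibniz, smul_eq_mul, smul_eq_mul, Function.iterate_succ_apply']
    simp only [RingHom.coe_coe, hρ]
    ring

theorem evalLam_map_lamDel_pow (ρ : DiffPoly F ι →ₐ[F] DiffPoly F ι')
    (hρ : ∀ u, ρ (del u) = del (ρ u)) (n : ℕ) (y : Polynomial (DiffPoly F ι)) :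
    evalLam w (((lamDel ^ n) y).map (ρ : DiffPoly F ι →+* DiffPoly F ι')) =
      (del (F := F) (ι := ι'))^[n] (evalLam w (y.map (ρ : DiffPoly F ι →+* DiffPoly F ι'))) := by
  induction n with
  | zero => rfl
  | succ n ih =>
    rw [pow_succ', Module.End.mul_apply, evalLam_map_lamDel w ρ hρ, ih,
      Function.iterate_succ_apply']

end Lambda

section AffineBracket

variable {F ι 𝔤 : Type*} [Field F] [Fintype ι] [LieRing 𝔤] [LieAlgebra F 𝔤]

theorem lin_add (b : Module.Basis ι F 𝔤) (a a' : 𝔤) : lin b (a + a') = lin b a + lin b a' := by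
  simp [lin, add_smul, Finset.sum_add_distrib]

theorem lin_smul (b : Module.Basis ι F 𝔤) (c : F) (a : 𝔤) : lin b (c • a) = c • lin b a := by
  simp [lin, mul_smul, Finset.smul_sum]

/-- The element `[a, b_j] + κ(s | [a, b_j]) + κ(a | b_j) λ`. -/
def affineGen (κ : LinearMap.BilinForm F 𝔤) (b : Module.Basis ι F 𝔤) (s : 𝔤) (j : ι) :
    𝔤 →ₗ[F] Polynomial (DiffPoly F ι) where
  toFun a := Polynomial.C (lin b ⁅a, b j⁆ + MvPolynomial.C (κ s ⁅a, b j⁆)) +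
      Polynomial.C (MvPolynomial.C (κ a (b j))) * Polynomial.X
  map_add' x y := by
    simp only [add_lie, lin_add, map_add, LinearMap.add_apply]
    ring
  map_smul' c x := by
    have hc : ∀ y : Polynomial (DiffPoly F ι), c • y = Polynomial.C (MvPolynomial.C c) * y :=
      fun y => Algebra.smul_def c y
    simp only [smul_lie, lin_smul, map_smul, LinearMap.smul_apply, smul_eq_mul, map_mul,
      RingHom.id_apply, map_add, MvPolynomial.smul_eq_C_mul, hc]
    ring

theorem affineGen_apply (κ : LinearMap.BilinForm F 𝔤) (b : Module.Basis ι F 𝔤) (s : 𝔤) (j : ι)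
    (a : 𝔤) : affineGen κ b s j a =
      Polynomial.C (lin b ⁅a, b j⁆ + MvPolynomial.C (κ s ⁅a, b j⁆)) +
      Polynomial.C (MvPolynomial.C (κ a (b j))) * Polynomial.X := rfl

theorem affineBracket_lin (κ : LinearMap.BilinForm F 𝔤) (b : Module.Basis ι F 𝔤) (s a : 𝔤)
    (g : DiffPoly F ι) :
    affineBracket κ b s (lin b a) g =
      MvPolynomial.mkDerivation F (fun v => (lamDel ^ v.2) (affineGen κ b s v.1 a)) g := by
  classical
  have hlin : ∀ i m, MvPolynomial.pderiv (i, m) (lin b a) =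
      if m = 0 then MvPolynomial.C (b.repr a i) else 0 := by
    intro i m
    rw [lin, map_sum, Finset.sum_eq_single i]
    · rw [Derivation.map_smul]
      split_ifs with h
      · rw [h, MvPolynomial.pderiv_X_self, MvPolynomial.smul_eq_C_mul, mul_one]
      · rw [MvPolynomial.pderiv_X_of_ne (by simpa using Ne.symm h), smul_zero]
    · intro j _ hj
      rw [Derivation.map_smul, MvPolynomial.pderiv_X_of_ne (by simp [hj]), smul_zero]
    · exact fun h => absurd (Finset.mem_univ _) h
  have hm : ∀ i j, (∑ᶠ m : ℕ, ∑ᶠ n : ℕ,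
      Polynomial.C (MvPolynomial.pderiv (j, n) g) *
        (lamDel ^ n) (applyShift (affineGen κ b s j (b i))
          (((-lamDel) ^ m) (Polynomial.C (MvPolynomial.pderiv (i, m) (lin b a)))))) =
      ∑ᶠ n : ℕ, MvPolynomial.pderiv (j, n) g •
        (lamDel ^ n) (b.repr a i • affineGen κ b s j (b i)) := by
    intro i j
    rw [finsum_eq_single _ 0]
    · refine finsum_congr fun n => ?_
      rw [hlin, if_pos rfl, pow_zero, Module.End.one_apply, applyShift_C_C, Polynomial.smul_eq_C_mul]
      congr 2
      rw [mul_comm, Algebra.smul_def]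
      rfl
    · intro m hm
      rw [finsum_eq_zero_of_forall_eq_zero]
      intro n
      rw [hlin, if_neg hm, map_zero, map_zero, applyShift_zero, map_zero, mul_zero]
  refine (Finset.sum_congr rfl fun i _ => Finset.sum_congr rfl fun j _ => hm i j).trans ?_
  refine (Finset.sum_congr rfl fun i _ => (mkDerivation_eq_sum_finsum (fun v : ι × ℕ =>
    (lamDel ^ v.2) (b.repr a i • affineGen κ b s v.1 (b i))) g).symm).trans ?_
  obtain ⟨K, hK⟩ := exists_vars_subset g
  simp only [mkDerivation_eq_sum _ g _ hK]
  rw [Finset.sum_comm]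
  refine Finset.sum_congr rfl fun v _ => ?_
  rw [← Finset.smul_sum, ← map_sum]
  simp only [← map_smul]
  rw [← map_sum, b.sum_repr]

end AffineBracket

namespace WData

variable {F 𝔤 P M : Type*} [Field F] [LieRing 𝔤] [LieAlgebra F 𝔤] (D : WData F 𝔤 P M)

theorem f_mem_grade [CharZero F] : D.f ∈ grade (F := F) D.h (-2) := by
  rw [mem_grade_iff, D.sl2.lie_lie_smul_f F]
  have : (2 : F) ≠ 0 := two_ne_zero
  rw [smul_neg, smul_smul, ← neg_smul]
  congr 1
  push_cast
  field_simp

theorem e_mem_grade [CharZero F] : D.e ∈ grade (F := F) D.h 2 := by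
  rw [mem_grade_iff, D.sl2.lie_h_e_smul F]
  have : (2 : F) ≠ 0 := two_ne_zero
  rw [smul_smul]
  congr 1
  push_cast
  field_simp

/-- `f` has degree `-1` and `𝔭` has no component of degree `1`; so `ρ` is the identity on `𝒱(𝔭)`. -/
theorem form_f_inl [CharZero F] (i : P) : D.κ D.f (D.b (Sum.inl i)) = 0 := by
  have : gradeLE (F := F) D.h 1 ≤ LinearMap.ker (D.κ D.f) :=
    iSup_le fun k x hx => form_eq_zero_of_grade D.κ D.κ_inv
      (by have := k.2; omega) D.f_mem_grade hx
  exact this (D.p_le (D.b_inl i))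

variable [Fintype P]

theorem linP_add (a a' : 𝔤) : D.linP (a + a') = D.linP a + D.linP a' := by
  simp [linP, add_smul, Finset.sum_add_distrib]

theorem linP_smul (c : F) (a : 𝔤) : D.linP (c • a) = c • D.linP a := by
  simp [linP, mul_smul, Finset.smul_sum]

theorem linP_inl (i : P) : D.linP (D.b (Sum.inl i)) = MvPolynomial.X (i, 0) := by
  classical
  rw [linP, Finset.sum_eq_single i] <;> simp +contextual [eq_comm]

theorem rho_X (i : P ⊕ M) (n : ℕ) : D.rho (MvPolynomial.X (i, n)) =
    (del : Derivation F (DiffPoly F P) (DiffPoly F P))^[n]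
      (D.linP (D.b i) + MvPolynomial.C (D.κ D.f (D.b i))) := by
  rw [rho, MvPolynomial.aeval_X]

theorem rho_del (u : DiffPoly F (P ⊕ M)) : D.rho (del u) = del (D.rho u) := by
  induction u using MvPolynomial.induction_on with
  | C c =>
    rw [MvPolynomial.derivation_C, ← MvPolynomial.algebraMap_eq, AlgHom.commutes,
      Derivation.map_algebraMap, map_zero]
  | add p q hp hq => simp only [map_add, hp, hq]
  | mul_X p v hp =>
    rw [← Prod.mk.eta (p := v)]
    simp only [Derivation.leibniz, map_add, smul_eq_mul, map_mul, hp, del_X, rho_X,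
      Function.iterate_succ_apply']

theorem rho_incl [CharZero F] (u : DiffPoly F P) : D.rho (incl (M := M) u) = u := by
  have : D.rho.comp (incl (M := M)) = AlgHom.id F (DiffPoly F P) := by
    refine MvPolynomial.algHom_ext fun v => ?_
    rw [AlgHom.comp_apply, incl, MvPolynomial.rename_X, rho_X, form_f_inl, map_zero, add_zero,
      linP_inl, AlgHom.id_apply]
    obtain ⟨i, n⟩ := v
    change (del : Derivation F (DiffPoly F P) (DiffPoly F P))^[n] (MvPolynomial.X (i, 0)) = _
    induction n with
    | zero => rfl
    | succ n ih => rw [Function.iterate_succ_apply', ih, del_X]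
  exact congrArg (fun φ => φ u) this

theorem rho_lin [Fintype M] (a : 𝔤) :
    D.rho (lin D.b a) = D.linP a + MvPolynomial.C (D.κ D.f a) := by
  let φ : 𝔤 →ₗ[F] DiffPoly F P :=
    { toFun := fun a => D.linP a + MvPolynomial.C (D.κ D.f a)
      map_add' := fun x y => by simp only [linP_add, map_add]; ring
      map_smul' := fun c x => by
        simp only [linP_smul, map_smul, smul_add, RingHom.id_apply, smul_eq_mul, map_mul,
          MvPolynomial.smul_eq_C_mul] }
  change _ = φ a
  conv_rhs => rw [← D.b.sum_repr a, map_sum]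
  rw [lin, map_sum]
  refine Finset.sum_congr rfl fun i _ => ?_
  rw [map_smul, map_smul, rho_X]
  rfl

/-- The infinitesimal gauge transformation of the generators `q_j` by `a ⊗ w`:
`ρ[a, q_j] w + κ(a | q_j) ∂w`. -/
def gaugeVar (a : 𝔤) (w : DiffPoly F P) (j : P) : DiffPoly F P :=
  (D.linP ⁅a, D.b (Sum.inl j)⁆ + MvPolynomial.C (D.κ D.f ⁅a, D.b (Sum.inl j)⁆)) * w +
    MvPolynomial.C (D.κ a (D.b (Sum.inl j))) * del w

/-- The elements of the W-algebra are gauge invariant: `λ^k ↦ ∂^k w` turns the polynomial identity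
`ρ{a_λ p} = 0` into the vanishing of an evolutionary vector field on `p`. -/
theorem evol_gaugeVar_eq_zero [CharZero F] [Fintype M] {z : F} {p : DiffPoly F P}
    (hp : p ∈ D.W z) {a : 𝔤} (ha : a ∈ nSub D.κ D.h D.f D.l) (w : DiffPoly F P) :
    evol (D.gaugeVar a w) p = 0 := by
  have h1 := congrArg (evalLam w) (hp a ha)
  rw [affineBracket_lin, map_zero] at h1
  have h2 : ∀ (y : (P ⊕ M) × ℕ → Polynomial (DiffPoly F (P ⊕ M))) (u : DiffPoly F P),
      evalLam w ((MvPolynomial.mkDerivation F y (incl (M := M) u)).map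
        (D.rho : DiffPoly F (P ⊕ M) →+* DiffPoly F P)) =
      MvPolynomial.mkDerivation F (fun v : P × ℕ => evalLam w ((y (Sum.inl v.1, v.2)).map
        (D.rho : DiffPoly F (P ⊕ M) →+* DiffPoly F P))) u := by
    intro y u
    induction u using MvPolynomial.induction_on with
    | C c =>
      rw [MvPolynomial.derivation_C, ← MvPolynomial.algebraMap_eq, AlgHom.commutes,
        Derivation.map_algebraMap, Polynomial.map_zero, map_zero]
    | add p q hp hq => simp only [map_add, Polynomial.map_add, hp, hq]
    | mul_X p v hp =>
      rw [map_mul, Derivation.leibniz, Derivation.leibniz, ← hp, MvPolynomial.mkDerivation_X]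
      simp only [Polynomial.map_add, Polynomial.smul_eq_C_mul, Polynomial.map_mul,
        Polynomial.map_C, map_add, RingHom.coe_coe, rho_incl]
      simp only [← Polynomial.smul_eq_C_mul, map_smul]
      rw [incl, MvPolynomial.rename_X, MvPolynomial.mkDerivation_X]
  rw [h2] at h1
  rw [← h1, evol]
  congr 2
  funext v
  rw [evalLam_map_lamDel_pow w D.rho D.rho_del]
  congr 1
  have hs : D.κ (z • D.s) ⁅a, D.b (Sum.inl v.1)⁆ = 0 := by
    rw [← D.κ_inv, smul_lie, D.s_comm a ha, smul_zero, map_zero, LinearMap.zero_apply]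
  rw [affineGen_apply, hs, map_zero, add_zero, Polynomial.C_mul_X_eq_monomial,
    ← Polynomial.monomial_zero_left, Polynomial.map_add, Polynomial.map_monomial,
    Polynomial.map_monomial, map_add, evalLam_monomial, evalLam_monomial, RingHom.coe_coe,
    rho_lin, gaugeVar, ← MvPolynomial.algebraMap_eq, ← MvPolynomial.algebraMap_eq,
    AlgHom.commutes]
  rfl

end WData

/-! ### Convergence modulo total derivatives -/

section AsympNull

variable {F ι : Type*} [Field F]

/-- A sequence of series tends to the space of total derivatives in the degree filtration. -/
def AsympNull (D : ℤ) (s : ℕ → Laur (DiffPoly F ι)) : Prop :=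
  ∀ N, ∀ᶠ K in Filter.atTop, s K ∈ totalDer F ι ⊔ ordGE F (DiffPoly F ι) D N

variable {D : ℤ} {s t : ℕ → Laur (DiffPoly F ι)}

theorem AsympNull.add (hs : AsympNull D s) (ht : AsympNull D t) :
    AsympNull D fun K => s K + t K := fun N => by
  filter_upwards [hs N, ht N] with K h1 h2 using add_mem h1 h2

theorem AsympNull.neg (hs : AsympNull D s) : AsympNull D fun K => -s K := fun N => by
  filter_upwards [hs N] with K h1 using neg_mem h1

theorem AsympNull.smul (hs : AsympNull D s) (c : F) : AsympNull D fun K => c • s K := fun N => by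
  filter_upwards [hs N] with K h1 using Submodule.smul_mem _ c h1

theorem asympNull_of_mem (hs : ∀ K, s K ∈ totalDer F ι) : AsympNull D s := fun _ =>
  Filter.Eventually.of_forall fun K => Submodule.mem_sup_left (hs K)

theorem asympNull_of_sub_mem (c : ℤ) (ht : ∀ K, t K ∈ totalDer F ι)
    (hst : ∀ K : ℕ, s (K + 1) - t (K + 1) ∈ ordGE F (DiffPoly F ι) D (K + c)) : AsympNull D s := by
  intro N
  filter_upwards [Filter.eventually_ge_atTop ((N - c).toNat + 1)] with K hK
  obtain ⟨K, rfl⟩ := Nat.exists_eq_succ_of_ne_zero (by omega : K ≠ 0)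
  have h1 : N ≤ K + c := by omega
  rw [← add_sub_cancel (t (K + 1)) (s (K + 1))]
  exact add_mem (Submodule.mem_sup_left (ht _)) (Submodule.mem_sup_right (ordGE_anti D h1 (hst K)))

theorem AsympNull.mono_mul (hs : AsympNull D s) (n : ℤ) : AsympNull D fun K => mono n 1 * s K := by
  intro N
  filter_upwards [hs (N - n * D)] with K hK
  obtain ⟨y, hy, w, hw, h⟩ := Submodule.mem_sup.1 hK
  rw [← h, mul_add]
  refine add_mem (Submodule.mem_sup_left (mono_mul_mem_totalDer hy n))
    (Submodule.mem_sup_right fun m hm => ?_)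
  rw [coeffL_mono_mul, hw (m - n) (by linarith), mul_zero]

theorem mem_totalDer_of_asympNull {x : Laur (DiffPoly F ι)} (h : AsympNull D fun _ => x) :
    x ∈ totalDer F ι :=
  mem_totalDer_of_forall fun N => (h N).exists.choose_spec

end AsympNull

/-! ### Laurent polynomials in `z` -/

section LaurPoly

variable {F 𝔤 ι : Type*} [Field F] [LieRing 𝔤] [LieAlgebra F 𝔤]

variable (F 𝔤 ι) in
/-- The Laurent polynomials `𝔤 ⊗ 𝒱[z, z⁻¹]` inside `(𝔤 ⊗ 𝒱)((z⁻¹))`. -/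
def laurPoly : Submodule F (GV F 𝔤 ι) :=
  Submodule.span F {x | ∃ (n : ℤ) (c : DiffPoly F ι) (a : 𝔤), x = mono n c ⊗ₜ a}

theorem mono_tmul_mem_laurPoly (n : ℤ) (c : DiffPoly F ι) (a : 𝔤) :
    mono n c ⊗ₜ[F] a ∈ laurPoly F 𝔤 ι := Submodule.subset_span ⟨n, c, a, rfl⟩

theorem lie_mem_laurPoly {x y : GV F 𝔤 ι} (hx : x ∈ laurPoly F 𝔤 ι) (hy : y ∈ laurPoly F 𝔤 ι) :
    ⁅x, y⁆ ∈ laurPoly F 𝔤 ι := by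
  refine Submodule.span_induction (p := fun x _ => ⁅x, y⁆ ∈ laurPoly F 𝔤 ι)
    ?_ (by simp) (fun x x' _ _ hx hx' => by rw [add_lie]; exact add_mem hx hx')
    (fun t x _ hx => by rw [smul_lie]; exact Submodule.smul_mem _ t hx) hx
  rintro _ ⟨m, u, a, rfl⟩
  refine Submodule.span_induction (p := fun y _ => ⁅mono m u ⊗ₜ[F] a, y⁆ ∈ laurPoly F 𝔤 ι)
    ?_ (by simp) (fun x x' _ _ hx hx' => by rw [lie_add]; exact add_mem hx hx')
    (fun t x _ hx => by rw [lie_smul]; exact Submodule.smul_mem _ t hx) hy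
  rintro _ ⟨n, v, b, rfl⟩
  rw [LieAlgebra.ExtendScalars.bracket_tmul, mono_mul_mono]
  exact mono_tmul_mem_laurPoly _ _ _

theorem coeffDer_mem_laurPoly (δ : Derivation F (DiffPoly F ι) (DiffPoly F ι)) {x : GV F 𝔤 ι}
    (hx : x ∈ laurPoly F 𝔤 ι) : coeffDer δ x ∈ laurPoly F 𝔤 ι := by
  refine Submodule.span_le (p := (laurPoly F 𝔤 ι).comap (coeffDer δ).toLinearMap).2 ?_ hx
  rintro _ ⟨m, u, a, rfl⟩
  change coeffDer δ (mono m u ⊗ₜ[F] a) ∈ laurPoly F 𝔤 ι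
  rw [coeffDer_tmul, mapL_mono]
  exact mono_tmul_mem_laurPoly _ _ _

end LaurPoly

section ExpLinear

variable {F R L : Type*} [Field F] [CommRing R] [LieRing L] [LieAlgebra F L] [LieAlgebra R L]
  [SMulCommClass R F L]

/-- The truncated exponentials are linear over every ring of scalars. -/
theorem expAd_smul (U x : L) (K : ℕ) (w : R) : expAd F U K (w • x) = w • expAd F U K x := by
  rw [expAd_apply, expAd_apply, Finset.smul_sum]
  refine Finset.sum_congr rfl fun k hk => ?_
  clear hk
  rw [smul_comm w]
  congr 1
  induction k with
  | zero => rfl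
  | succ k ih =>
    rw [pow_succ', Module.End.mul_apply, Module.End.mul_apply, ih, LieAlgebra.ad_apply,
      LieAlgebra.ad_apply, lie_smul]

end ExpLinear

namespace WData

variable {F 𝔤 P M : Type*} [Field F] [LieRing 𝔤] [LieAlgebra F 𝔤] (D : WData F 𝔤 P M)

/-! ### The degree of `s` and the subalgebras `𝔪 ⊆ 𝔫` -/

theorem iSup_grade_eq_top : ⨆ k, grade (F := F) D.h k = ⊤ := by
  refine top_le_iff.1 (D.compl.sup_eq_top ▸ sup_le (sup_le ?_ ?_) ?_)
  · exact D.l_le.trans (le_iSup (fun k => grade (F := F) D.h k) 1)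
  · exact iSup_le fun k => le_iSup (fun k => grade (F := F) D.h k) k
  · exact D.p_le.trans (iSup_le fun k => le_iSup (fun k => grade (F := F) D.h k) k)

theorem mSub_le_nSub : mSub D.h D.l ≤ nSub D.κ D.h D.f D.l :=
  sup_le_sup_right (fun a ha => ⟨D.l_le ha, fun b hb => D.l_isotropic a ha b hb⟩) _

/-- If `s = 0`, then `f` lies both in the kernel and in the image of `ad f`. -/
theorem s_ne_zero [CharZero F] (hdec : Disjoint D.hSub D.imSub) : D.s ≠ 0 := by
  intro hs
  have hf : D.fzs = 1 ⊗ₜ[F] D.f := by rw [fzs, hs, TensorProduct.tmul_zero, add_zero]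
  have h1 : (1 : Laur F) ⊗ₜ[F] D.f ∈ D.hSub := by
    rw [hSub, LinearMap.mem_ker, LieAlgebra.ad_apply, hf, lie_self]
  have h2 : (1 : Laur F) ⊗ₜ[F] D.f ∈ D.imSub := by
    refine ⟨1 ⊗ₜ[F] ((2 : F)⁻¹ • D.h), ?_⟩
    have h2 : (2 : F) ≠ 0 := two_ne_zero
    rw [LieAlgebra.ad_apply, hf, LieAlgebra.ExtendScalars.bracket_tmul, mul_one, lie_smul,
      ← lie_skew, D.sl2.lie_lie_smul_f F, neg_neg, smul_smul, inv_mul_cancel₀ h2, one_smul]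
  have h3 := congrArg (coeffG F 𝔤 0) (Submodule.disjoint_def.1 hdec _ h1 h2)
  rw [map_zero] at h3
  refine D.sl2.f_ne_zero ?_
  have h4 : coeffL F F 0 1 = 1 := by rw [← mono_zero_one, coeffL_mono, if_pos rfl]
  rw [← h3, coeffG, LinearMap.comp_apply, coeffZ, LinearMap.rTensor_tmul, h4]
  simp

/-- `s` is a highest weight vector of a finite-dimensional `sl₂`-module. -/
theorem degree_nonneg [CharZero F] [FiniteDimensional F 𝔤] (hdec : Disjoint D.hSub D.imSub) {d : ℤ}
    (hs : D.s ∈ grade (F := F) D.h d) : 0 ≤ d := by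
  have h2 : (2 : F) ≠ 0 := two_ne_zero
  have he : D.e ∈ nSub D.κ D.h D.f D.l :=
    Submodule.mem_sup_right (Submodule.mem_iSup_of_mem ⟨2, by norm_num⟩ D.e_mem_grade)
  have hprim : D.sl2.HasPrimitiveVectorWith D.s (d : F) :=
    { ne_zero := D.s_ne_zero hdec
      lie_h := by
        rw [mem_grade_iff] at hs
        have := congrArg (fun x => (2 : F) • x) hs
        simp only [smul_smul, mul_inv_cancel₀ h2, one_smul, mul_div_cancel₀ _ h2] at this
        exact this
      lie_e := by rw [← lie_skew, D.s_comm _ he, neg_zero] }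
  obtain ⟨n, hn⟩ := hprim.exists_nat
  have : d = n := by exact_mod_cast hn
  omega

/-! ### The operator `L(z)` -/

section Operator

theorem tensorOne_fzs {A : Type*} [CommRing A] [Algebra F A] :
    tensorOne (A := A) D.fzs = mono 0 1 ⊗ₜ D.f + mono (-1) 1 ⊗ₜ D.s := by
  rw [fzs, map_add, tensorOne_tmul, tensorOne_tmul, ← mono_zero_one, mapL_mono, mapL_mono]
  simp

variable [Fintype P] [Finite M]

theorem L_left : D.L.left =
    (∑ i : P, mono 0 (MvPolynomial.X (i, 0)) ⊗ₜ D.qDual i) + tensorOne D.fzs := rfl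

theorem lieL_eq (x : GV F 𝔤 P) : D.lieL x = ⁅D.L.left, x⁆ + coeffDer del x := by
  change ⁅D.L.left, x⁆ + delAction D.L.right x - delAction (0 : FDel F) D.L.left = _
  rw [map_zero, LieDerivation.zero_apply, sub_zero]
  congr 2
  exact delAction_one

theorem kappaZ_lieL_add (x y : GV F 𝔤 P) :
    kappaZ D.κ (D.lieL x) y + kappaZ D.κ x (D.lieL y) ∈ totalDer F P := by
  have h : kappaZ D.κ (D.lieL x) y + kappaZ D.κ x (D.lieL y) =
      mapL del.toLinearMap (kappaZ D.κ x y) := by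
    rw [mapL_kappaZ, lieL_eq, lieL_eq, kappaZ_add_left, kappaZ_add_right, ← kappaZ_lie D.κ_inv,
      ← lie_skew x, kappaZ_symm D.κ_symm (-_), kappaZ_neg_right, kappaZ_symm D.κ_symm y]
    abel
  rw [h]
  exact mapL_del_mem _

theorem inlGV_lieL (x : GV F 𝔤 P) :
    inlGV F 𝔤 P (D.lieL x) = ⁅toDerGV F 𝔤 P D.L, inlGV F 𝔤 P x⁆ := by
  refine LieAlgebra.SemiDirectSum.ext ?_ ?_
  · change _ = ⁅D.L.left, x⁆ + delAction D.L.right x -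
      (0 : LieDerivation F (GV F 𝔤 P) (GV F 𝔤 P)) D.L.left
    rw [LieDerivation.zero_apply, sub_zero]
    change D.lieL x = _
    rw [lieL_eq]
    congr 2
    exact delAction_one.symm
  · change 0 = ⁅_, (0 : LieDerivation F (GV F 𝔤 P) (GV F 𝔤 P))⁆
    rw [lie_zero]

theorem lieL_mem_laurPoly {x : GV F 𝔤 P} (hx : x ∈ laurPoly F 𝔤 P) :
    D.lieL x ∈ laurPoly F 𝔤 P := by
  rw [lieL_eq]
  refine add_mem (lie_mem_laurPoly ?_ hx) (coeffDer_mem_laurPoly _ hx)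
  rw [L_left, tensorOne_fzs]
  exact add_mem (Submodule.sum_mem _ fun i _ => mono_tmul_mem_laurPoly _ _ _)
    (add_mem (mono_tmul_mem_laurPoly _ _ _) (mono_tmul_mem_laurPoly _ _ _))

/-- The evolutionary vector field `X_Q` maps `L(z)` to `∑ q^i ⊗ Q_i`. -/
theorem coeffDer_evol_L (Q : P → DiffPoly F P) :
    coeffDer (evol Q) D.L.left = ∑ i : P, mono 0 (Q i) ⊗ₜ D.qDual i := by
  rw [L_left, map_add, coeffDer_tensorOne, add_zero, map_sum]
  refine Finset.sum_congr rfl fun i _ => ?_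
  rw [coeffDer_tmul, mapL_mono]
  congr 2
  exact evol_X Q i 0

end Operator

/-! ### The `κ`-dual basis -/

section Dual

variable [Finite P] [Finite M]

/-- The basis of `𝔤` that is `κ`-dual to the basis `b`; its first part is `(q^i)`. -/
def dualB : Module.Basis (P ⊕ M) F 𝔤 :=
  open Classical in D.κ.dualBasis D.κ_nondeg D.b

theorem qDual_eq (i : P) : D.qDual i = D.dualB (Sum.inl i) := rfl

theorem form_dualB_left (i : P ⊕ M) (c : 𝔤) : D.κ (D.dualB i) c = D.b.repr c i := by
  classical
  have : D.κ (D.dualB i) = D.b.coord i := D.b.ext fun j => by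
    rw [dualB, LinearMap.BilinForm.apply_dualBasis_left, Module.Basis.coord_apply,
      Module.Basis.repr_self, Finsupp.single_apply]
  rw [this]; rfl

end Dual

section Dual

variable [Fintype P] [Fintype M]

theorem sum_form_smul_dualB (c : 𝔤) : ∑ i, D.κ (D.b i) c • D.dualB i = c := by
  classical
  conv_rhs => rw [← D.dualB.sum_repr c]
  refine Finset.sum_congr rfl fun i _ => ?_
  rw [dualB, LinearMap.BilinForm.dualBasis_repr_apply, D.κ_symm]

theorem sum_kappaZ_smul_dualB (x : GV F 𝔤 P) :
    ∑ i, kappaZ D.κ (1 ⊗ₜ D.b i) x • ((1 : Laur (DiffPoly F P)) ⊗ₜ[F] D.dualB i) = x := by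
  induction x using TensorProduct.induction_on with
  | zero => simp [kappaZ_zero_right]
  | add x y hx hy => simp only [kappaZ_add_right, add_smul, Finset.sum_add_distrib, hx, hy]
  | tmul u c =>
    conv_rhs => rw [← D.sum_form_smul_dualB c, TensorProduct.tmul_sum]
    refine Finset.sum_congr rfl fun i _ => ?_
    rw [kappaZ_tmul, one_mul, TensorProduct.smul_tmul', smul_eq_mul, mul_one,
      TensorProduct.smul_tmul]

theorem sum_form_qDual_smul_X (c : 𝔤) :
    ∑ k : P, D.κ (D.qDual k) c • (MvPolynomial.X (k, 0) : DiffPoly F P) = D.linP c :=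
  Finset.sum_congr rfl fun k _ => by rw [qDual_eq, form_dualB_left]

end Dual

/-! ### Gauge invariance -/

section Gauge

variable [Fintype P] [Fintype M]

/-- The `q_i`-component of `[L(z), w ⊗ a]` is the gauge variation of `q_i`; the term with `z` vanishes
since `[s, 𝔫] = 0`. -/
theorem kappaZ_lieL_tmul {a : 𝔤} (ha : a ∈ nSub D.κ D.h D.f D.l) (w : Laur (DiffPoly F P)) (i : P)
    (n : ℤ) : coeffL F _ n (kappaZ D.κ (D.lieL (w ⊗ₜ a)) (1 ⊗ₜ D.b (Sum.inl i))) =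
      D.gaugeVar a (coeffL F _ n w) i := by
  have h1 : kappaZ D.κ (D.lieL (w ⊗ₜ a)) (1 ⊗ₜ D.b (Sum.inl i)) =
      mono 0 (D.linP ⁅a, D.b (Sum.inl i)⁆) * w + D.κ D.f ⁅a, D.b (Sum.inl i)⁆ • w +
        D.κ a (D.b (Sum.inl i)) • mapL del.toLinearMap w := by
    rw [lieL_eq, L_left, tensorOne_fzs, add_lie, add_lie, coeffDer_tmul, kappaZ_add_left,
      kappaZ_add_left, kappaZ_add_left, LieAlgebra.ExtendScalars.bracket_tmul,
      LieAlgebra.ExtendScalars.bracket_tmul, D.s_comm a ha, TensorProduct.tmul_zero,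
      kappaZ_zero_left, add_zero, kappaZ_tmul, kappaZ_tmul, mono_zero_one, D.κ_inv, one_mul,
      mul_one, mul_one, sum_lie]
    congr 2
    rw [← sum_form_qDual_smul_X, ← monoLin_apply (F := F), map_sum, Finset.sum_mul,
      kappaZ_symm D.κ_symm, kappaZ_sum_right]
    refine Finset.sum_congr rfl fun k _ => ?_
    rw [LieAlgebra.ExtendScalars.bracket_tmul, kappaZ_tmul, one_mul, D.κ_symm, D.κ_inv, map_smul,
      smul_mul_assoc, monoLin_apply]
  rw [h1, map_add, map_add, map_smul, map_smul, coeffL_mono_mul, coeffL_mapL, sub_zero, gaugeVar,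
    MvPolynomial.smul_eq_C_mul, MvPolynomial.smul_eq_C_mul, add_mul]
  rfl

/-- For `p` in the W-algebra, `[L(z), δp/δq]` is orthogonal to `𝔫` modulo total derivatives. -/
theorem kappaZ_tmul_lieL_varDerZ_mem [CharZero F] {z : F} {p : DiffPoly F P} (hp : p ∈ D.W z)
    {a : 𝔤} (ha : a ∈ nSub D.κ D.h D.f D.l) (w : Laur (DiffPoly F P)) :
    kappaZ D.κ (w ⊗ₜ a) (D.lieL (D.varDerZ (mono 0 p))) ∈ totalDer F P := by
  refine (Submodule.add_mem_iff_right _ ?_).1 (D.kappaZ_lieL_add (w ⊗ₜ a) (D.varDerZ (mono 0 p)))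
  intro n
  have h1 : kappaZ D.κ (D.lieL (w ⊗ₜ a)) (D.varDerZ (mono 0 p)) =
      ∑ i, mono 0 (varDer i p) * kappaZ D.κ (D.lieL (w ⊗ₜ a)) (1 ⊗ₜ D.b (Sum.inl i)) := by
    rw [varDerZ, kappaZ_sum_right]
    refine Finset.sum_congr rfl fun i _ => ?_
    rw [← kappaZ_mul_right, TensorProduct.smul_tmul', smul_eq_mul, mul_one, mapL_mono]
  rw [h1, map_sum]
  simp only [coeffL_mono_mul, sub_zero, D.kappaZ_lieL_tmul ha]
  have h2 := sum_varDer_mul_sub_mem (D.gaugeVar a (coeffL F _ n w)) p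
  rwa [D.evol_gaugeVar_eq_zero hp ha, sub_zero] at h2

end Gauge

/-! ### The generating function of the integrals of motion -/

section Solution

theorem lie_tensorOne_solution {ι : Type*} {hz : GV F 𝔤 ι} (B : HomBasis F D.h)
    {a : Laur F ⊗[F] 𝔤} (ha : a ∈ D.hCenter)
    (hh : hz ∈ extendSub (DiffPoly F ι) (D.hSub.restrictScalars F)) :
    ⁅tensorOne (A := DiffPoly F ι) a, tensorOne D.fzs + hz⁆ = 0 := by
  have h1 : ⁅a, D.fzs⁆ = 0 := by
    have := ha.1
    rw [hSub, LinearMap.mem_ker, LieAlgebra.ad_apply] at this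
    rw [← lie_skew, this, neg_zero]
  rw [lie_add, ← tensorOne_lie, h1, map_zero, zero_add]
  refine B.eq_zero_of_contractions fun φ => ?_
  rw [rTensor_tensorOne_lie, tensorOne_self]
  exact ha.2 _ ((Submodule.mem_iInf _).1 hh φ)

variable [Fintype P] [Finite M] {d : ℤ} {U hz : GV F 𝔤 P}

/-- The truncated exponentials converge to `e^{ad U(z)} L(z)` in the degree filtration. -/
theorem expAd_L_sub_mem (B : HomBasis F D.h) (hU : U ∈ fil (F := F) (DiffPoly F P) D.h (d + 2) 1)
    {Y : DelGV F 𝔤 P} (hY : IsExpAd U D.L Y) {k : ℤ}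
    (hL : toDerGV F 𝔤 P D.L ∈ filDer F P D.h (d + 2) k) (K : ℕ) :
    expAd F (inlGV F 𝔤 P U) K (toDerGV F 𝔤 P D.L) - toDerGV F 𝔤 P Y ∈
      filDer F P D.h (d + 2) (K + k) := by
  let S : ℕ → DelGV F 𝔤 P := fun K => expAd F (LieAlgebra.SemiDirectSum.inl _ U) K D.L
  have hS : ∀ K, toDerGV F 𝔤 P (S K) = expAd F (inlGV F 𝔤 P U) K (toDerGV F 𝔤 P D.L) := fun K => by
    rw [lieHom_expAd]
    congr 2
    rw [toDerGV_apply]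
    refine LieAlgebra.SemiDirectSum.ext rfl ?_
    exact map_zero _
  have hlim : ∀ n, ∃ K', K ≤ K' ∧ (S K').right = Y.right ∧
      coeffZ F 𝔤 (DiffPoly F P) n (S K').left = coeffZ F 𝔤 (DiffPoly F P) n Y.left := fun n => by
    obtain ⟨K', hK', h⟩ := ((Filter.eventually_ge_atTop K).and (hY n)).exists
    refine ⟨K', hK', ?_⟩
    simp only [S, expAd_apply]
    exact h
  have hc : ∀ K', K ≤ K' → toDerGV F 𝔤 P (S K') - toDerGV F 𝔤 P (S K) ∈
      filDer F P D.h (d + 2) (K + k) := fun K' h => by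
    rw [hS, hS]
    exact (isLieFiltration_filDer D.h (d + 2)).expAd_sub_expAd_mem (inlGV_mem_filDer.2 hU) hL h
  rw [← hS]
  refine ⟨?_, ?_⟩
  · change (S K).left - Y.left ∈ _
    rw [B.mem_fil_iff]
    intro i n hn
    obtain ⟨K', hK', _, h⟩ := hlim n
    have h1 : coeffL F _ n (B.coordL _ i ((S K').left - (S K).left)) = 0 :=
      B.mem_fil_iff.1 (hc K' hK').1 i n hn
    have h2 : coeffL F _ n (B.coordL _ i ((S K').left - Y.left)) = 0 :=
      B.coeffL_coordL_eq_zero (by rw [map_sub, h, sub_self]) i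
    rw [map_sub, map_sub] at h1 h2 ⊢
    rw [← sub_sub_sub_cancel_left _ _ (coeffL F _ n (B.coordL (DiffPoly F P) i (S K').left)),
      h1, h2, sub_self]
  · obtain ⟨K', hK', h, _⟩ := hlim 0
    have h1 := (neg_mem (hc K' hK')).2
    have h2 : (toDerGV F 𝔤 P (S K) - toDerGV F 𝔤 P Y).right =
        (-(toDerGV F 𝔤 P (S K') - toDerGV F 𝔤 P (S K))).right := by
      rw [neg_sub]
      change delAction (S K).right - delAction Y.right =
        delAction (S K).right - delAction (S K').right
      rw [h]
    rw [h2]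
    exact h1

/-- The series `U(z)` of positive degree dresses `L(z)` into `∂ + (f + zs) ⊗ 1 + h(z)`, the limit of
the truncated exponentials in the degree filtration, and `a(z) ⊗ 1` commutes with
`(f + zs) ⊗ 1 + h(z)`. Here `z` has the negative degree `-(d + 2)/2`. -/
structure IsDressing (d : ℤ) (U hz : GV F 𝔤 P) (a : Laur F ⊗[F] 𝔤) : Prop where
  pos : 0 < d + 2
  U_mem : U ∈ fil (F := F) (DiffPoly F P) D.h (d + 2) 1
  approx : ∃ k, toDerGV F 𝔤 P D.L ∈ filDer F P D.h (d + 2) k ∧ ∀ K : ℕ,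
    expAd F (inlGV F 𝔤 P U) K (toDerGV F 𝔤 P D.L) - ⟨tensorOne D.fzs + hz, coeffDer del⟩ ∈
      filDer F P D.h (d + 2) (K + k)
  lie_eq_zero : ⁅tensorOne (A := DiffPoly F P) a, tensorOne D.fzs + hz⁆ = 0

theorem isDressing_of_isSolution [CharZero F] [FiniteDimensional F 𝔤] (hd : 0 ≤ d)
    (hsol : D.IsSolution d U hz) {a : Laur F ⊗[F] 𝔤} (ha : a ∈ D.hCenter) :
    D.IsDressing d U hz a := by
  obtain ⟨B⟩ := exists_homBasis D.iSup_grade_eq_top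
  have hpos : 0 < d + 2 := by omega
  have hU := B.extendSub_gzGT_le d 0 hsol.1
  rw [zero_add] at hU
  have hh : hz ∈ extendSub (DiffPoly F P) (D.hSub.restrictScalars F) :=
    (Submodule.mem_iInf _).2 fun φ => ((Submodule.mem_iInf _).1 hsol.2.1 φ).1
  obtain ⟨k, hk⟩ := exists_mem_fil D.iSup_grade_eq_top hpos D.L.left
  have hk' := (isLieFiltration_fil D.h (d + 2)).anti (min_le_left k 0) hk
  have hL : toDerGV F 𝔤 P D.L ∈ filDer F P D.h (d + 2) (min k 0) := by
    have := mk_coeffDer_mem_filDer (del (F := F) (ι := P)) (min_le_right k 0) hk'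
    rwa [← delAction_one] at this
  refine ⟨hpos, hU, ⟨min k 0, hL, fun K => ?_⟩, D.lie_tensorOne_solution B ha hh⟩
  have hY : toDerGV F 𝔤 P ⟨tensorOne D.fzs + hz, FDel.one⟩ =
      ⟨tensorOne D.fzs + hz, coeffDer del⟩ := by rw [toDerGV_apply, delAction_one]
  rw [← hY]
  exact D.expAd_L_sub_mem B hU hsol.2.2 hL K

namespace IsDressing

variable {D} {a : Laur F ⊗[F] 𝔤}

/-- The functional `x ↦ ∫ κ(a | e^{ad U} x)` vanishes on the image of `ad L(z)`. -/
theorem asympNull_lieL [CharZero F] (S : D.IsDressing d U hz a) (y : GV F 𝔤 P) :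
    AsympNull (d + 2) fun K => kappaZ D.κ (tensorOne a) (expAd F U K (D.lieL y)) := by
  obtain ⟨k, hL, happ⟩ := S.approx
  obtain ⟨m, hy⟩ := exists_mem_fil D.iSup_grade_eq_top S.pos y
  obtain ⟨r, ha⟩ := exists_mem_fil D.iSup_grade_eq_top S.pos (tensorOne (A := DiffPoly F P) a)
  have hfil := isLieFiltration_filDer (F := F) (ι := P) D.h (d + 2)
  have hU := inlGV_mem_filDer.2 S.U_mem
  have hy' := inlGV_mem_filDer.2 hy
  refine asympNull_of_sub_mem (r + k + m + 1)
    (t := fun K => mapL del.toLinearMap (kappaZ D.κ (tensorOne a) (expAd F U K y)))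
    (fun K => mapL_del_mem _) fun K => ?_
  set K' := K + 1
  have h1 := hfil.expAd_lie_sub_mem hU hL hy' K'
  have h2 := hfil.lie_mem (happ K') (hfil.expAd_mem hU hy' K')
  rw [sub_lie] at h2
  have h3 := sub_mem h2 h1
  rw [sub_sub_sub_cancel_left, ← inlGV_lieL, ← lieHom_expAd, ← lieHom_expAd] at h3
  have h4 : expAd F U K' (D.lieL y) - (⁅tensorOne D.fzs + hz, expAd F U K' y⁆ +
      coeffDer del (expAd F U K' y)) ∈ fil (F := F) (DiffPoly F P) D.h (d + 2) (K' + k + m) := by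
    have := h3.1
    change expAd F U K' (D.lieL y) - (⁅tensorOne D.fzs + hz, expAd F U K' y⁆ +
      coeffDer del (expAd F U K' y) - (0 : LieDerivation F (GV F 𝔤 P) (GV F 𝔤 P)) _) ∈ _ at this
    rwa [LieDerivation.zero_apply, sub_zero] at this
  have h5 := kappaZ_mem_ordGE D.κ_inv ha h4
  rw [kappaZ_sub_right, kappaZ_add_right, ← kappaZ_lie D.κ_inv, S.lie_eq_zero, kappaZ_zero_left,
    zero_add] at h5
  rw [mapL_kappaZ, coeffDer_tensorOne, kappaZ_zero_left, zero_add]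
  have h6 : (r : ℤ) + ((K' : ℕ) + k + m) = K + (r + k + m + 1) := by
    simp only [K']; push_cast; ring
  rwa [h6] at h5

/-- The variation of `∫ κ(a | h(z))` along an evolutionary vector field `X` is
`∫ κ(a | e^{ad U} X(L))`. -/
theorem asympNull_variation [CharZero F] (S : D.IsDressing d U hz a) (X : Derivation F (DiffPoly F P) (DiffPoly F P))
    (hX : ∀ u, X (del u) = del (X u)) :
    AsympNull (d + 2) fun K =>
      kappaZ D.κ (tensorOne a) (expAd F U K (coeffDer X D.L.left)) -
        mapL X.toLinearMap (kappaZ D.κ (tensorOne a) hz) := by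
  obtain ⟨k, hL, happ⟩ := S.approx
  obtain ⟨r, ha⟩ := exists_mem_fil D.iSup_grade_eq_top S.pos (tensorOne (A := DiffPoly F P) a)
  have hfil := isLieFiltration_filDer (F := F) (ι := P) D.h (d + 2)
  have hU := inlGV_mem_filDer.2 S.U_mem
  let ξ : DerGV F 𝔤 P := ⟨0, coeffDer X⟩
  have hξ : ξ ∈ filDer F P D.h (d + 2) 0 := mk_coeffDer_mem_filDer X le_rfl (zero_mem _)
  -- the element `e^{ad U} X = X + η` of the semidirect product
  let η : ℕ → GV F 𝔤 P := fun K => (expAd F (inlGV F 𝔤 P U) K ξ).left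
  have hcomm : ⁅(coeffDer X : LieDerivation F (GV F 𝔤 P) (GV F 𝔤 P)),
      (coeffDer del : LieDerivation F (GV F 𝔤 P) (GV F 𝔤 P))⁆ = 0 := by
    refine LieDerivation.ext fun x => ?_
    rw [LieDerivation.lie_apply, LieDerivation.zero_apply, sub_eq_zero]
    induction x using TensorProduct.induction_on with
    | zero => simp
    | add x y hx hy => simp only [map_add, hx, hy]
    | tmul u c =>
      simp only [coeffDer_tmul]
      congr 1
      exact laur_ext F fun n => hX _
  have hξL : ⁅ξ, toDerGV F 𝔤 P D.L⁆ = inlGV F 𝔤 P (coeffDer X D.L.left) := by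
    refine LieAlgebra.SemiDirectSum.ext ?_ ?_
    · change ⁅(0 : GV F 𝔤 P), D.L.left⁆ + coeffDer X D.L.left - delAction D.L.right 0 = _
      rw [zero_lie, map_zero, zero_add, sub_zero]
      rfl
    · change ⁅coeffDer X, delAction FDel.one⁆ = 0
      rw [delAction_one, hcomm]
  refine asympNull_of_sub_mem (r + k + 1)
    (t := fun K => -mapL del.toLinearMap (kappaZ D.κ (tensorOne a) (η K)))
    (fun K => neg_mem (mapL_del_mem _)) fun K => ?_
  set K' := K + 1 with hK'
  have h1 := hfil.expAd_lie_sub_mem hU hξ hL K'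
  have h2 := hfil.lie_mem (hfil.expAd_mem hU hξ K') (happ K')
  rw [lie_sub, zero_add] at h2
  rw [add_zero, hξL, ← lieHom_expAd] at h1
  have h3 := sub_mem h2 h1
  rw [sub_sub_sub_cancel_left] at h3
  have h4 : expAd F U K' (coeffDer X D.L.left) - (⁅η K', tensorOne D.fzs + hz⁆ +
      coeffDer X (tensorOne D.fzs + hz) - coeffDer del (η K')) ∈
      fil (F := F) (DiffPoly F P) D.h (d + 2) (K' + k) := by
    have := h3.1
    change expAd F U K' (coeffDer X D.L.left) - (⁅η K', tensorOne D.fzs + hz⁆ +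
      (expAd F (inlGV F 𝔤 P U) (K + 1) ξ).right (tensorOne D.fzs + hz) -
      coeffDer del (η K')) ∈ _ at this
    rwa [expAd_inlGV_right] at this
  have h5 := kappaZ_mem_ordGE D.κ_inv ha h4
  rw [kappaZ_sub_right, kappaZ_sub_right, kappaZ_add_right, ← lie_skew, kappaZ_neg_right,
    ← kappaZ_lie D.κ_inv, S.lie_eq_zero, kappaZ_zero_left, neg_zero, zero_add, map_add,
    coeffDer_tensorOne, zero_add] at h5
  rw [mapL_kappaZ, mapL_kappaZ, coeffDer_tensorOne, coeffDer_tensorOne, kappaZ_zero_left,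
    kappaZ_zero_left, zero_add, zero_add, sub_neg_eq_add]
  have h6 : (r : ℤ) + ((K' : ℕ) + k) = K + (r + k + 1) := by
    rw [hK']; push_cast; ring
  rw [h6] at h5
  convert h5 using 1
  abel

/-- The weak form of `δg/δq = π_𝔭 (e^{-ad U} a)` for `∫ g = ∫ κ(a | h(z))`. The restriction to Laurent
polynomials `x` reduces it to variations of `q` that do not involve `z`. -/
theorem asympNull_varDer [CharZero F] [Fintype M] (S : D.IsDressing d U hz a) {g : Laur (DiffPoly F P)}
    (hg : intZ g = intZ (kappaZ D.κ (tensorOne a) hz)) {x : GV F 𝔤 P}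
    (hx : x ∈ laurPoly F 𝔤 P) :
    AsympNull (d + 2) fun K =>
      ∑ i, mapL (varDer i) g * kappaZ D.κ (1 ⊗ₜ D.b (Sum.inl i)) x -
        kappaZ D.κ (tensorOne a) (expAd F U K
          (∑ i, kappaZ D.κ (1 ⊗ₜ D.b (Sum.inl i)) x •
            ((1 : Laur (DiffPoly F P)) ⊗ₜ[F] D.qDual i))) := by
  induction hx using Submodule.span_induction with
  | zero =>
    refine asympNull_of_mem fun K => ?_
    simp only [kappaZ_zero_right, mul_zero, zero_smul, Finset.sum_const_zero, map_zero, sub_zero]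
    exact zero_mem _
  | add x y _ _ hx hy =>
    convert hx.add hy using 2 with K
    simp only [kappaZ_add_right, mul_add, add_smul, Finset.sum_add_distrib, map_add]
    abel
  | smul c x _ hx =>
    convert hx.smul c using 2 with K
    simp only [kappaZ_smul_right, mul_smul_comm, smul_assoc, ← Finset.smul_sum, map_smul, smul_sub]
  | mem x hx =>
    obtain ⟨n, c, b, rfl⟩ := hx
    let Q : P → DiffPoly F P := fun i => D.κ (D.b (Sum.inl i)) b • c
    have hQ : ∀ i, kappaZ D.κ (1 ⊗ₜ D.b (Sum.inl i)) (mono n c ⊗ₜ b) = mono n 1 * mono 0 (Q i) :=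
      fun i => by
        rw [kappaZ_tmul, one_mul, mono_mul_mono, add_zero, one_mul, ← monoLin_apply (F := F),
          ← monoLin_apply (F := F), map_smul]
    have h1 := S.asympNull_variation (evol Q) (evol_del Q)
    have h2 := sum_varDer_mul_mono_sub_mem Q g
    have h3 := mapL_mem_totalDer (evol Q) (evol_del Q) ((intZ_eq_iff _ _).1 hg)
    rw [map_sub] at h3
    have h4 := (((asympNull_of_mem (D := d + 2) fun _ => add_mem h2 h3)).add h1.neg).mono_mul n
    convert h4 using 2 with K
    have h5 : ∑ i, (mono n 1 * mono 0 (Q i)) • ((1 : Laur (DiffPoly F P)) ⊗ₜ[F] D.qDual i) =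
        mono n (1 : DiffPoly F P) • coeffDer (evol Q) D.L.left := by
      rw [coeffDer_evol_L, Finset.smul_sum]
      refine Finset.sum_congr rfl fun i _ => ?_
      rw [mul_smul, TensorProduct.smul_tmul' (mono 0 (Q i)), smul_eq_mul, mul_one]
    simp only [hQ]
    rw [h5, expAd_smul, kappaZ_mul_right]
    simp only [mul_left_comm _ (mono n (1 : DiffPoly F P)), ← Finset.mul_sum]
    ring

/-- The Lenard–Magri recursion: up to total derivatives, the pairing of `δg/δq` with
`x = [L(z), δp/δq]` is `κ(a | e^{ad U} y)` for the component `y` of `x` in `𝔪^⊥`, and both `x` and its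
component in `𝔭^⊥` contribute zero. -/
theorem kappaZ_lieL_varDerZ_mem [CharZero F] [Fintype M] (S : D.IsDressing d U hz a)
    {g : Laur (DiffPoly F P)} (hg : intZ g = intZ (kappaZ D.κ (tensorOne a) hz))
    {z : F} {p : DiffPoly F P} (hp : p ∈ D.W z) :
    kappaZ D.κ (D.lieL (D.varDerZ g)) (D.varDerZ (mono 0 p)) ∈ totalDer F P := by
  set x := D.lieL (D.varDerZ (mono 0 p)) with hxdef
  have hx : x ∈ laurPoly F 𝔤 P := by
    refine D.lieL_mem_laurPoly (Submodule.sum_mem _ fun i _ => ?_)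
    rw [mapL_mono]
    exact mono_tmul_mem_laurPoly _ _ _
  refine (Submodule.add_mem_iff_left _ ?_).1
    (D.kappaZ_lieL_add (D.varDerZ g) (D.varDerZ (mono 0 p)))
  rw [← hxdef]
  have hgx : kappaZ D.κ (D.varDerZ g) x =
      ∑ i, mapL (varDer i) g * kappaZ D.κ (1 ⊗ₜ D.b (Sum.inl i)) x := by
    rw [kappaZ_symm D.κ_symm, varDerZ, kappaZ_sum_right]
    refine Finset.sum_congr rfl fun i _ => ?_
    rw [kappaZ_symm D.κ_symm _ x, ← kappaZ_mul_right, TensorProduct.smul_tmul', smul_eq_mul,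
      mul_one]
  -- `x` is the sum of its components in `𝔪^⊥` and `𝔭^⊥`
  have hsplit : ∑ i, kappaZ D.κ (1 ⊗ₜ D.b (Sum.inl i)) x •
      ((1 : Laur (DiffPoly F P)) ⊗ₜ[F] D.qDual i) =
      x - ∑ j, kappaZ D.κ (1 ⊗ₜ D.b (Sum.inr j)) x •
        ((1 : Laur (DiffPoly F P)) ⊗ₜ[F] D.dualB (Sum.inr j)) := by
    rw [eq_sub_iff_add_eq]
    conv_rhs => rw [← D.sum_kappaZ_smul_dualB x, Fintype.sum_sum_type]
    rfl
  have hM : ∀ (w : Laur (DiffPoly F P)) (j : M),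
      kappaZ D.κ (1 ⊗ₜ D.b (Sum.inr j)) x * w ∈ totalDer F P := fun w j => by
    have := D.kappaZ_tmul_lieL_varDerZ_mem hp (D.mSub_le_nSub (D.b_inr j)) w
    rwa [← hxdef, ← mul_one w, ← smul_eq_mul, ← TensorProduct.smul_tmul', kappaZ_mul_left,
      mul_comm] at this
  refine mem_totalDer_of_asympNull (D := d + 2) ?_
  have h1 := ((S.asympNull_varDer hg hx).add (S.asympNull_lieL (D.varDerZ (mono 0 p)))).add
    (asympNull_of_mem (D := d + 2) (s := fun K =>
      -∑ j, kappaZ D.κ (1 ⊗ₜ D.b (Sum.inr j)) x * kappaZ D.κ (tensorOne a)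
        (expAd F U K ((1 : Laur (DiffPoly F P)) ⊗ₜ[F] D.dualB (Sum.inr j))))
      fun K => neg_mem (Submodule.sum_mem _ fun j _ => hM _ j))
  convert h1 using 2 with K
  rw [hgx, hsplit, map_sub, kappaZ_sub_right, map_sum, kappaZ_sum_right]
  simp only [expAd_smul, kappaZ_mul_right]
  ring

end IsDressing

end Solution

end WData

end DSW

end

theorem theorem4 {F 𝔤 P M : Type*} [Field F] [CharZero F] [LieRing 𝔤] [LieAlgebra F 𝔤]
    [FiniteDimensional F 𝔤] [Fintype P] [Fintype M]
    (hred : LieAlgebra.radical F 𝔤 = LieAlgebra.center F 𝔤)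
    (D : DSW.WData F 𝔤 P M)
    (d : ℤ) (hs : D.s ∈ DSW.grade (F := F) D.h d)
    (hdec : IsCompl D.hSub D.imSub)
    (U hz : DSW.GV F 𝔤 P) (hsol : D.IsSolution d U hz)
    (a : DSW.Laur F ⊗[F] 𝔤) (ha : a ∈ D.hCenter)
    (g : DSW.Laur (DSW.DiffPoly F P))
    (hg : DSW.intZ g = DSW.intZ (DSW.kappaZ D.κ (DSW.tensorOne a) hz))
    (z₀ : F) (p : DSW.DiffPoly F P) (hp : p ∈ D.W z₀) :
    DSW.intZ (DSW.kappaZ D.κ (D.lieL (D.varDerZ g)) (D.varDerZ (DSW.mono 0 p))) = 0 := by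
  have hd : 0 ≤ d := D.degree_nonneg hdec.disjoint hs
  exact (DSW.intZ_eq_zero_iff _).2
    ((D.isDressing_of_isSolution hd hsol ha).kappaZ_lieL_varDerZ_mem hg hp)
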